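/- Let $(M,g)$ be a smooth (finite-dimensional) Riemannian manifold with Levi-Civita connection $\nabla$, let $\pi:TM\to M$ be its tangent bundle, and let $K:TTM\to TM$ be the connection map of $\nabla$, so that in the coordinates $(x,v)$ of $TM$ induced by coordinates $x$ of $M$ one has $K(\dot x,\dot v)=\dot v+\Gamma_x(\dot x,v)$. For $u\in TM$ and $a\in T_{\pi(u)}M$, the vertical lift $a^v\in T_uTM$ is the derivative at $t=0$ of $t\mapsto u+ta$, and the horizontal lift $a^h\in T_uTM$ is the unique vector with $d\pi(a^h)=a$ and $K(a^h)=0$. A vector field on an open subset of $TM$ is horizontal if $K$ vanishes on it. Let $B$ be the mirror endomorphism of $TTM$, which sends the horizontal lift of a vector to its vertical lift and sends vertical vectors to $0$, that is, $B_u(y)=(d\pi(y))^v$. Let $\nabla^*$ be the connection on $TTM$ that is the direct sum of two copies of the pull-back connection $\pi^*\nabla$ under the splitting $TTM\simeq\pi^*TM\oplus\pi^*TM$ given by $(d\pi,K)$, that is, $\nabla^*_yX=\big((\pi^*\nabla)_y(d\pi X)\big)^h+\big((\pi^*\nabla)_y(KX)\big)^v$. The Lie derivative of $B$ is $(\mathcal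 L_XB)Y=[X,BY]-B[X,Y]$. Let $U\subset M$ be open. (1) For every smooth vector field $X$ on $\pi^{-1}(U)\subset TM$ and every $Y\in T(\pi^{-1}(U))$, $$(\mathcal L_XB)Y=B\nabla^*_YX-\nabla^*_{BY}X.$$ (2) Let $X^h$ be a smooth horizontal vector field on $\pi^{-1}(U)$ and let $\lambda:\pi^{-1}(U)\to\mathbb R$ be a function. Then $\mathcal L_{X^h}B=\lambda B$ on $\pi^{-1}(U)$ if and only if $\lambda$ is constant along the fibres of $\pi$ and $X^h$ is the horizontal lift of a smooth vector field $X$ on $U$ such that $\nabla_YX=\lambda Y$ for all $Y\in TU$ (where $\lambda$ is regarded as a function on $U$). -/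

import Mathlib

open VectorField
open scoped Manifold ContDiff Topology

noncomputable section

namespace MirrorMap

variable {E : Type*} [NormedAddCommGroup E] [NormedSpace ℝ E]
  {M : Type*} [TopologicalSpace M] [ChartedSpace E M] [IsManifold 𝓘(ℝ, E) ∞ M]

variable (E M) in
/-- A smooth Riemannian metric on the manifold `M` (without boundary, modelled on `E`). -/
abbrev Metric : Type _ :=
  Bundle.ContMDiffRiemannianMetric 𝓘(ℝ, E) ∞ E (fun p : M ↦ TangentSpace 𝓘(ℝ, E) p)

variable (E M) in
/-- The tangent manifold `TM`, with model `𝓘(ℝ, E).tangent`. -/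
abbrev TM : Type _ := TangentBundle 𝓘(ℝ, E) M

/-- The tangent space `T_p M`. -/
abbrev TanM (p : M) : Type _ := TangentSpace 𝓘(ℝ, E) p

/-- The tangent space `T_u TM` at a point `u` of the tangent manifold. -/
abbrev TanTM (u : TM E M) : Type _ := TangentSpace 𝓘(ℝ, E).tangent u

/-- `X` is a smooth vector field on the open subset `s` of `M` (its values outside `s` are
irrelevant). -/
def SmoothFieldOn (X : ∀ p : M, TanM (E := E) p) (s : Set M) : Prop :=
  ContMDiffOn 𝓘(ℝ, E) 𝓘(ℝ, E).tangent ∞ (fun p ↦ (⟨p, X p⟩ : TM E M)) s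

/-- `X` is a smooth vector field on the open subset `s` of `TM` (its values outside `s` are
irrelevant). -/
def SmoothFieldOnTM (X : ∀ u : TM E M, TanTM u) (s : Set (TM E M)) : Prop :=
  ContMDiffOn 𝓘(ℝ, E).tangent 𝓘(ℝ, E).tangent.tangent ∞
    (fun u ↦ (⟨u, X u⟩ : TangentBundle 𝓘(ℝ, E).tangent (TM E M))) s

/-- `Y` is a smooth vector field on `TM` in a neighbourhood of `u`. -/
def SmoothFieldAtTM (Y : ∀ u : TM E M, TanTM u) (u : TM E M) : Prop :=
  ContMDiffAt 𝓘(ℝ, E).tangent 𝓘(ℝ, E).tangent.tangent ∞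
    (fun u' ↦ (⟨u', Y u'⟩ : TangentBundle 𝓘(ℝ, E).tangent (TM E M))) u

/-! ### The Levi-Civita connection -/

/-- The coefficients of the metric in the preferred chart `x` at `p`: the bilinear form
`(a, b) ↦ g (∂_a, ∂_b)` at the point `x⁻¹ e`, where `∂_a = d(x⁻¹)_e a` is the coordinate
vector field of direction `a`. -/
def metricInChart (g : Metric E M) (p : M) (e : E) : E →L[ℝ] E →L[ℝ] ℝ :=
  let φ : E → M := (extChartAt 𝓘(ℝ, E) p).symm
  let A : E →L[ℝ] E := mfderiv 𝓘(ℝ, E) 𝓘(ℝ, E) φ e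
  let G : E →L[ℝ] E →L[ℝ] ℝ := g.inner (φ e)
  G.bilinearComp A A

/-- The Christoffel symbol of the first kind at `p` in the preferred chart at `p`, as a linear
form in the last argument:
`c ↦ ½ (∂_a g (b, c) + ∂_b g (a, c) - ∂_c g (a, b))`. -/
def christoffelFirst (g : Metric E M) (p : M) (a b : E) : E →L[ℝ] ℝ :=
  let D : E →L[ℝ] E →L[ℝ] E →L[ℝ] ℝ :=
    fderiv ℝ (metricInChart g p) (extChartAt 𝓘(ℝ, E) p p)
  (1 / 2 : ℝ) • (D a b + D b a - (D.flip a).flip b)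

/-- The Christoffel symbol (of the second kind) at `p` in the preferred chart at `p`: the vector
`Γ_p (a, b) = ∇_{∂_a} ∂_b` which satisfies `g (Γ_p (a, b), c) = christoffelFirst g p a b c` for
all `c`. The tangent space `T_p M` is identified with `E` by the preferred chart at `p`, as
everywhere in Mathlib. -/
def christoffel (g : Metric E M) (p : M) (a b : TanM (E := E) p) : TanM (E := E) p :=
  let G : E →L[ℝ] E →L[ℝ] ℝ := g.inner p
  G.inverse (christoffelFirst g p a b)

/-- The differential `dπ : T_u TM → T_{π u} M` of the projection `π : TM → M`. -/
def dproj (u : TM E M) : TanTM u →L[ℝ] TanM (E := E) u.proj :=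
  mfderiv 𝓘(ℝ, E).tangent 𝓘(ℝ, E) (fun u' : TM E M ↦ u'.proj) u

/-- The derivative of the fibre coordinate `v` of the chart `(x, v)` of `TM` which is induced by
the preferred chart `x` of `M` at `π u`. -/
def dfibre (u : TM E M) : TanTM u →L[ℝ] TanM (E := E) u.proj :=
  mfderiv 𝓘(ℝ, E).tangent 𝓘(ℝ, E)
    (fun u' : TM E M ↦ (trivializationAt E (TangentSpace 𝓘(ℝ, E)) u.proj u').2) u

/-- The connection map (connector) `K : T_u TM → T_{π u} M` of the Levi-Civita connection:
in the coordinates `(x, v)` of `TM` it is `K (ẋ, v̇) = v̇ + Γ (ẋ, v)`. -/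
def connector (g : Metric E M) (u : TM E M) (w : TanTM u) : TanM (E := E) u.proj :=
  dfibre u w + christoffel g u.proj (dproj u w) u.snd

/-- The covariant derivative along a map. A section along `f : N → M` (equivalently, a section of
the pull-back bundle `f^* TM`) is a map `s : N → TM` with `π ∘ s = f`; its derivative in the
direction `y ∈ T_x N` with respect to the pull-back `f^* ∇` of the Levi-Civita connection is
`K (ds (y))`. -/
def covDerivAlong {F : Type*} [NormedAddCommGroup F] [NormedSpace ℝ F]
    {H : Type*} [TopologicalSpace H] {J : ModelWithCorners ℝ F H}
    {N : Type*} [TopologicalSpace N] [ChartedSpace H N]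
    (g : Metric E M) (s : N → TM E M) (x : N) (y : TangentSpace J x) :
    TanM (E := E) (s x).proj :=
  connector g (s x) (mfderiv J 𝓘(ℝ, E).tangent s x y)

/-- The Levi-Civita connection `∇_y X` of `M`, for `y ∈ T_p M`. -/
def nabla (g : Metric E M) (X : ∀ p : M, TanM (E := E) p) (p : M) (y : TanM (E := E) p) :
    TanM (E := E) p :=
  covDerivAlong (J := 𝓘(ℝ, E)) g (fun q ↦ (⟨q, X q⟩ : TM E M)) p y

/-! ### The splitting of `TTM`, the mirror map and the connection `∇^*` -/

/-- The vertical lift `T_{π u} M → T_u TM`: the differential at `u` of the inclusion of the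
fibre `T_{π u} M` into `TM`. -/
def vertLift (u : TM E M) : TanM (E := E) u.proj →L[ℝ] TanTM u :=
  mfderiv 𝓘(ℝ, E) 𝓘(ℝ, E).tangent (fun v : E ↦ (⟨u.proj, v⟩ : TM E M)) (u.snd : E)

/-- A vector of `TTM` is horizontal if it is in the kernel of the connection map. -/
def IsHorizontal (g : Metric E M) {u : TM E M} (w : TanTM u) : Prop :=
  connector g u w = 0

/-- The lift of `a ∈ T_{π u} M` to `T_u TM` whose fibre component in the induced
coordinates `(x, v)` is zero. -/
def coordLift (u : TM E M) : TanM (E := E) u.proj →L[ℝ] TanTM u :=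
  mfderiv 𝓘(ℝ, E) 𝓘(ℝ, E).tangent
    (fun q : M ↦ (⟨q, (trivializationAt E (TangentSpace 𝓘(ℝ, E)) u.proj).symm q u.snd⟩ : TM E M))
    u.proj

/-- The horizontal lift of `a ∈ T_{π u} M` to `T_u TM`: the vector `h` with `dπ h = a` and
`K h = 0`, that is `(ẋ, v̇) = (a, - Γ (a, v))` in coordinates. -/
def horLift (g : Metric E M) (u : TM E M) (a : TanM (E := E) u.proj) : TanTM u :=
  coordLift u a - vertLift u (christoffel g u.proj a u.snd)

/-- The mirror map `B` of `TTM`: it sends the horizontal lift of a vector to its vertical lift,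
and vertical vectors to zero. -/
def mirror (u : TM E M) : TanTM u →L[ℝ] TanTM u :=
  (vertLift u).comp (dproj u)

/-- The connection `∇^*` on `TTM = H ⊕ V`, where the horizontal bundle `H` and the vertical
bundle `V` are both identified with `π^* TM`, by `dπ` and by `K`: the direct sum of two copies of
the pull-back `π^* ∇` of the Levi-Civita connection. The value is `∇^*_y X` for
`y ∈ T_u TM`. -/
def nablaStar (g : Metric E M) (X : ∀ u : TM E M, TanTM u) (u : TM E M) (y : TanTM u) :
    TanTM u :=
  horLift g u (covDerivAlong (J := 𝓘(ℝ, E).tangent) g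
      (fun u' ↦ (⟨u'.proj, dproj u' (X u')⟩ : TM E M)) u y)
    + vertLift u (covDerivAlong (J := 𝓘(ℝ, E).tangent) g
      (fun u' ↦ (⟨u'.proj, connector g u' (X u')⟩ : TM E M)) u y)

/-- The Lie derivative of an endomorphism field `A` of `TTM`:
`(L_X A) Y = [X, A Y] - A [X, Y]`. -/
def lieDerivEnd (A : ∀ u : TM E M, TanTM u →L[ℝ] TanTM u) (X Y : ∀ u : TM E M, TanTM u)
    (u : TM E M) : TanTM u :=
  mlieBracket 𝓘(ℝ, E).tangent X (fun u' ↦ A u' (Y u')) u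
    - A u (mlieBracket 𝓘(ℝ, E).tangent X Y u)

end MirrorMap

end

/-! Everything is computed in the coordinates `(x, v)` of `TM` induced by a chart of `M`. There `B`
has constant coefficients, `B (y¹, y²) = (0, y¹)`, so the derivatives of `Y` cancel in `[X, BY] -
B[X, Y]`. What remains (`lieDerivEnd_mirror`) has base component `-∂_{BY} X¹` and fibre component
`∂_Y X¹ - ∂_{BY} X²`.

On the other side, `∇*` differentiates `X¹` and `K X = X² + Γ(X¹, v)`. Along the vertical vector
`BY` the base point is fixed, so no derivative of `Γ` occurs, and the remaining Christoffel terms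
cancel because `Γ` is symmetric; this is (1), `lieDerivEnd_mirror_eq`. Since `connector` uses at
each `u` the chart centred at `π u`, differentiating `K X` requires `K` in one fixed chart. This is
`chartDeriv_connector`, which rests on the transformation law `christoffelMap_change` of the
Christoffel symbols.

For (2), `λB` takes vertical values, so the base component of `L_X B = λB` says that `dπ X` has zero
derivative along the fibres. Hence `dπ X` is fibrewise constant and comes from a field on `M`, of
which the horizontal field is the lift. For such a lift `(L_X B) Y` is the vertical lift of `∇_{dπ
Y} X` (`lieDerivEnd_mirror_horLift`), and both directions follow by comparison with `λ (dπ Y)^v`. -/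

noncomputable section

namespace MirrorMap

variable {E : Type*} [NormedAddCommGroup E] [NormedSpace ℝ E]
  {M : Type*} [TopologicalSpace M] [ChartedSpace E M] [IsManifold 𝓘(ℝ, E) ∞ M]

/-! ### Coordinates on the tangent bundle -/

/-- The derivative of a map from `TM` to a vector space. -/
def tderiv {F : Type*} [NormedAddCommGroup F] [NormedSpace ℝ F] (f : TM E M → F) (u : TM E M) :
    TanTM u →L[ℝ] F :=
  mfderiv 𝓘(ℝ, E).tangent 𝓘(ℝ, F) f u

/-- The base coordinate `x` of the chart `(x, v)` of `TM` induced by the preferred chart at `p`. -/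
def baseCoord (p : M) (u : TM E M) : E := extChartAt 𝓘(ℝ, E) p u.proj

/-- The fibre coordinate `v` of the chart `(x, v)` of `TM` induced by the preferred chart at `p`. -/
def fibreCoord (p : M) (u : TM E M) : E := (trivializationAt E (TangentSpace 𝓘(ℝ, E)) p u).2

/-- The derivative at `q` of the preferred chart at `p`. -/
def chartDeriv (p q : M) : TanM (E := E) q →L[ℝ] E :=
  mfderiv 𝓘(ℝ, E) 𝓘(ℝ, E) (extChartAt 𝓘(ℝ, E) p) q

/-- The trivialization of the tangent bundle at `p` acts on fibres by the differential of the chart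
at `p`. Every later change of fibre coordinate goes through this linear description. -/
lemma fibreCoord_eq {p : M} {u : TM E M} (h : u.proj ∈ (chartAt E p).source) :
    fibreCoord p u = chartDeriv p u.proj u.snd := by
  have := TangentBundle.continuousLinearMapAt_trivializationAt (I := 𝓘(ℝ, E)) h
  unfold chartDeriv
  rw [← this]
  rw [Bundle.Trivialization.continuousLinearMapAt_apply, Bundle.Trivialization.coe_linearMapAt_of_mem _ (by simpa using h)]
  rfl

lemma extChartAt_tangentBundle (u u' : TM E M) :
    extChartAt 𝓘(ℝ, E).tangent u u' = (baseCoord u.proj u', fibreCoord u.proj u') := by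
  rw [FiberBundle.extChartAt]
  rfl

@[simp] lemma chartDeriv_self (p : M) (a : TanM (E := E) p) : chartDeriv p p a = a := by
  unfold chartDeriv
  rw [mfderiv_extChartAt_self]
  rfl

lemma contMDiffAt_baseCoord {p : M} {u : TM E M} (h : u.proj ∈ (chartAt E p).source) :
    ContMDiffAt 𝓘(ℝ, E).tangent 𝓘(ℝ, E) ∞ (baseCoord p) u :=
  (contMDiffAt_extChartAt' h).comp u (Bundle.contMDiffAt_proj _)

lemma contMDiffAt_fibreCoord {p : M} {u : TM E M} (h : u.proj ∈ (chartAt E p).source) :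
    ContMDiffAt 𝓘(ℝ, E).tangent 𝓘(ℝ, E) ∞ (fibreCoord p) u := by
  have := ((trivializationAt E (TangentSpace 𝓘(ℝ, E)) p).contMDiffAt_iff (IB := 𝓘(ℝ, E)) (n := ∞)
    (f := fun u : TM E M ↦ u) (x₀ := u) (IM := 𝓘(ℝ, E).tangent) (by simpa using h)).1 contMDiffAt_id
  exact this.2

section

variable {F : Type*} [NormedAddCommGroup F] [NormedSpace ℝ F]
  {F' : Type*} [NormedAddCommGroup F'] [NormedSpace ℝ F']

lemma tderiv_congr {f f' : TM E M → F} {u : TM E M} (h : f =ᶠ[𝓝 u] f') :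
    tderiv f u = tderiv f' u := by
  unfold tderiv
  exact h.mfderiv_eq

lemma tderiv_const (c : F) (u : TM E M) : tderiv (fun _ ↦ c) u = 0 := by
  unfold tderiv
  exact mfderiv_const

lemma tderiv_comp {f : TM E M → F} {G : F → F'} {u : TM E M}
    (hG : DifferentiableAt ℝ G (f u))
    (hf : MDifferentiableAt 𝓘(ℝ, E).tangent 𝓘(ℝ, F) f u) (w : TanTM u) :
    tderiv (fun u' ↦ G (f u')) u w = fderiv ℝ G (f u) (tderiv f u w) := by
  have := (hG.hasFDerivAt.hasMFDerivAt.comp u hf.hasMFDerivAt).mfderiv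
  have h2 := congrArg (fun A : TanTM u →L[ℝ] F' ↦ A w) this
  exact h2

lemma tderiv_prodMk {f : TM E M → F} {f' : TM E M → F'} {u : TM E M}
    (hf : MDifferentiableAt 𝓘(ℝ, E).tangent 𝓘(ℝ, F) f u)
    (hf' : MDifferentiableAt 𝓘(ℝ, E).tangent 𝓘(ℝ, F') f' u) (w : TanTM u) :
    tderiv (fun u' ↦ (f u', f' u')) u w = (tderiv f u w, tderiv f' u w) := by
  have h := hf.prodMk_space hf'
  refine Prod.ext ?_ ?_
  · have := tderiv_comp (f := fun u' ↦ (f u', f' u')) (G := Prod.fst) differentiableAt_fst h w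
    rw [fderiv_fst] at this
    exact this.symm
  · have := tderiv_comp (f := fun u' ↦ (f u', f' u')) (G := Prod.snd) differentiableAt_snd h w
    rw [fderiv_snd] at this
    exact this.symm

lemma tderiv_clm_apply {A : TM E M → F →L[ℝ] F'} {f : TM E M → F} {u : TM E M}
    (hA : MDifferentiableAt 𝓘(ℝ, E).tangent 𝓘(ℝ, F →L[ℝ] F') A u)
    (hf : MDifferentiableAt 𝓘(ℝ, E).tangent 𝓘(ℝ, F) f u) (w : TanTM u) :
    tderiv (fun u' ↦ A u' (f u')) u w = tderiv A u w (f u) + A u (tderiv f u w) := by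
  have h : DifferentiableAt ℝ (fun z : (F →L[ℝ] F') × F ↦ z.1 z.2) (A u, f u) := by fun_prop
  have h1 := tderiv_comp (f := fun u' ↦ (A u', f u')) (G := fun z : (F →L[ℝ] F') × F ↦ z.1 z.2)
    h (hA.prodMk_space hf) w
  rw [h1, tderiv_prodMk hA hf, fderiv_clm_apply (by fun_prop) (by fun_prop)]
  simp [fderiv_fst, fderiv_snd, add_comm]

end

lemma eventually_mem_chart_source {p : M} {u : TM E M} (h : u.proj ∈ (chartAt E p).source) :
    ∀ᶠ u' in 𝓝 u, u'.proj ∈ (chartAt E p).source :=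
  (FiberBundle.continuous_proj E (TangentSpace 𝓘(ℝ, E))).continuousAt.eventually
    ((chartAt E p).open_source.mem_nhds h)

lemma mdifferentiableAt_baseCoord {p : M} {u : TM E M} (h : u.proj ∈ (chartAt E p).source) :
    MDifferentiableAt 𝓘(ℝ, E).tangent 𝓘(ℝ, E) (baseCoord p) u :=
  (contMDiffAt_baseCoord h).mdifferentiableAt (by decide)

lemma mdifferentiableAt_fibreCoord {p : M} {u : TM E M} (h : u.proj ∈ (chartAt E p).source) :
    MDifferentiableAt 𝓘(ℝ, E).tangent 𝓘(ℝ, E) (fibreCoord p) u :=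
  (contMDiffAt_fibreCoord h).mdifferentiableAt (by decide)

lemma tderiv_baseCoord {p : M} {u : TM E M} (h : u.proj ∈ (chartAt E p).source) (w : TanTM u) :
    tderiv (baseCoord p) u w = chartDeriv p u.proj (dproj u w) := by
  have h1 : MDifferentiableAt 𝓘(ℝ, E).tangent 𝓘(ℝ, E) (fun u' : TM E M ↦ u'.proj) u :=
    Bundle.mdifferentiableAt_proj _
  have := mfderiv_comp u (mdifferentiableAt_extChartAt (I := 𝓘(ℝ, E)) h) h1
  have h2 := congrArg (fun A : TanTM u →L[ℝ] E ↦ A w) this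
  exact h2

lemma tderiv_fibreCoord_self (u : TM E M) (w : TanTM u) :
    tderiv (fibreCoord u.proj) u w = dfibre u w := rfl

lemma tderiv_baseCoord_self (u : TM E M) (w : TanTM u) :
    tderiv (baseCoord u.proj) u w = dproj u w := by
  rw [tderiv_baseCoord (mem_chart_source E u.proj)]
  exact chartDeriv_self _ _

/-- The coordinate expression of a tangent vector `w ∈ T_{u'} TM` in the chart of `TM` at `u`. -/
lemma mfderiv_extChartAt_tangentBundle {u u' : TM E M}
    (h : u'.proj ∈ (chartAt E u.proj).source) (w : TanTM u') :
    (mfderiv 𝓘(ℝ, E).tangent 𝓘(ℝ, E × E) (extChartAt 𝓘(ℝ, E).tangent u) u' w : E × E) =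
      (tderiv (baseCoord u.proj) u' w, tderiv (fibreCoord u.proj) u' w) := by
  rw [← tderiv_prodMk (mdifferentiableAt_baseCoord h) (mdifferentiableAt_fibreCoord h)]
  have : (extChartAt 𝓘(ℝ, E).tangent u : TM E M → E × E) =
    fun u' ↦ (baseCoord u.proj u', fibreCoord u.proj u') := funext (extChartAt_tangentBundle u)
  unfold tderiv
  exact congrArg (fun f : TM E M → E × E ↦
    (mfderiv 𝓘(ℝ, E).tangent 𝓘(ℝ, E × E) f u' w : E × E)) this

/-- The preferred chart of `TM` at `u` has identity differential at `u` itself, so a vector of `T_u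
TM` is literally its pair of coordinates. -/
lemma tanTM_eq_prod {u : TM E M} (w : TanTM u) : w = ((dproj u w, dfibre u w) : E × E) := by
  have := mfderiv_extChartAt_tangentBundle (mem_chart_source E u.proj) w
  rw [mfderiv_extChartAt_self, tderiv_baseCoord_self, tderiv_fibreCoord_self] at this
  exact this

lemma tanTM_ext {u : TM E M} {w w' : TanTM u} (h1 : dproj u w = dproj u w')
    (h2 : dfibre u w = dfibre u w') : w = w' := by
  rw [tanTM_eq_prod w, tanTM_eq_prod w', h1, h2]

/-! ### Lifts -/

lemma contMDiff_fibreInclusion (p : M) :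
    ContMDiff 𝓘(ℝ, E) 𝓘(ℝ, E).tangent ∞ (fun v : E ↦ (⟨p, v⟩ : TM E M)) := by
  intro v
  rw [Bundle.contMDiffAt_totalSpace]
  refine ⟨contMDiffAt_const, ?_⟩
  have : (fun v : E ↦ (trivializationAt E (TangentSpace 𝓘(ℝ, E)) p (⟨p, v⟩ : TM E M)).2) =
      fun v ↦ (chartDeriv p p : E →L[ℝ] E) v :=
    funext fun v ↦ fibreCoord_eq (p := p) (u := ⟨p, v⟩) (mem_chart_source E p)
  show ContMDiffAt 𝓘(ℝ, E) 𝓘(ℝ, E) ∞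
    (fun v : E ↦ (trivializationAt E (TangentSpace 𝓘(ℝ, E)) p (⟨p, v⟩ : TM E M)).2) v
  rw [this]
  exact (ContinuousLinearMap.contMDiff _).contMDiffAt

lemma tderiv_vertLift {F : Type*} [NormedAddCommGroup F] [NormedSpace ℝ F] {f : TM E M → F}
    {u : TM E M} (hf : MDifferentiableAt 𝓘(ℝ, E).tangent 𝓘(ℝ, F) f u)
    (a : TanM (E := E) u.proj) :
    tderiv f u (vertLift u a) = fderiv ℝ (fun v : E ↦ f ⟨u.proj, v⟩) u.snd a := by
  have h := mfderiv_comp (I := 𝓘(ℝ, E)) (I' := 𝓘(ℝ, E).tangent) (I'' := 𝓘(ℝ, F))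
    (f := fun v : E ↦ (⟨u.proj, v⟩ : TM E M)) (g := f) (u.snd : E) hf
    ((contMDiff_fibreInclusion u.proj).contMDiffAt.mdifferentiableAt (by decide))
  have h2 := congrArg (fun A : E →L[ℝ] F ↦ A a) h
  have h3 := mfderiv_eq_fderiv (𝕜 := ℝ) (f := fun v : E ↦ f ⟨u.proj, v⟩) (x := (u.snd : E))
  exact h2.symm.trans (congrArg (fun A : E →L[ℝ] F ↦ A a) h3)

/-- On a single fibre the fibre coordinate is linear, hence its own derivative. -/
lemma tderiv_fibreCoord_vertLift {p : M} {u : TM E M} (h : u.proj ∈ (chartAt E p).source)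
    (a : TanM (E := E) u.proj) :
    tderiv (fibreCoord p) u (vertLift u a) = chartDeriv p u.proj a := by
  rw [tderiv_vertLift (mdifferentiableAt_fibreCoord h)]
  have : (fun v : E ↦ fibreCoord p (⟨u.proj, v⟩ : TM E M)) =
      fun v ↦ (chartDeriv p u.proj : E →L[ℝ] E) v :=
    funext fun v ↦ fibreCoord_eq (p := p) (u := ⟨u.proj, v⟩) h
  rw [this]
  exact congrArg (fun A : E →L[ℝ] E ↦ A a)
    (ContinuousLinearMap.fderiv (chartDeriv p u.proj : E →L[ℝ] E))

@[simp] lemma dfibre_vertLift (u : TM E M) (a : TanM (E := E) u.proj) :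
    dfibre u (vertLift u a) = a := by
  rw [← tderiv_fibreCoord_self, tderiv_fibreCoord_vertLift (mem_chart_source E _),
    chartDeriv_self]

@[simp] lemma dproj_vertLift (u : TM E M) (a : TanM (E := E) u.proj) :
    dproj u (vertLift u a) = 0 := by
  rw [← tderiv_baseCoord_self, tderiv_vertLift
    (mdifferentiableAt_baseCoord (mem_chart_source E u.proj))]
  have : (fun v : E ↦ baseCoord u.proj (⟨u.proj, v⟩ : TM E M)) =
    fun v ↦ extChartAt 𝓘(ℝ, E) u.proj u.proj := rfl
  rw [this]
  simp
  rfl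

/-- The section through `u` with constant fibre coordinate. -/
def coordSection (u : TM E M) (q : M) : TM E M :=
  ⟨q, (trivializationAt E (TangentSpace 𝓘(ℝ, E)) u.proj).symm q u.snd⟩

lemma fibreCoord_coordSection {u : TM E M} {q : M} (h : q ∈ (chartAt E u.proj).source) :
    fibreCoord u.proj (coordSection u q) = u.snd := by
  have := Bundle.Trivialization.apply_mk_symm (trivializationAt E (TangentSpace 𝓘(ℝ, E)) u.proj)
    (b := q) (by simpa using h) (u.snd : E)
  exact congrArg Prod.snd this

lemma coordSection_self (u : TM E M) : coordSection u u.proj = u := by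
  have h := fibreCoord_coordSection (mem_chart_source E u.proj)
  rw [fibreCoord_eq (p := u.proj) (u := coordSection u u.proj) (mem_chart_source E u.proj)] at h
  have h' : (coordSection u u.proj).snd = u.snd := (chartDeriv_self (E := E) u.proj _).symm.trans h
  exact congrArg (fun v ↦ (⟨u.proj, v⟩ : TM E M)) h'

lemma mdifferentiableAt_coordSection (u : TM E M) :
    MDifferentiableAt 𝓘(ℝ, E) 𝓘(ℝ, E).tangent (coordSection u) u.proj := by
  have : ContMDiffAt 𝓘(ℝ, E) 𝓘(ℝ, E).tangent 1 (coordSection u) u.proj := by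
    rw [Bundle.contMDiffAt_totalSpace]
    refine ⟨contMDiffAt_id, (contMDiffAt_const (M' := E) (c := u.snd)).congr_of_eventuallyEq ?_⟩
    filter_upwards [(chartAt E u.proj).open_source.mem_nhds (mem_chart_source E u.proj)] with q hq
    exact fibreCoord_coordSection hq
  exact this.mdifferentiableAt one_ne_zero

lemma tderiv_coordLift {F : Type*} [NormedAddCommGroup F] [NormedSpace ℝ F] {f : TM E M → F}
    {u : TM E M} (hf : MDifferentiableAt 𝓘(ℝ, E).tangent 𝓘(ℝ, F) f u)
    (a : TanM (E := E) u.proj) :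
    tderiv f u (coordLift u a) =
      (mfderiv 𝓘(ℝ, E) 𝓘(ℝ, F) (f ∘ coordSection u) u.proj : E →L[ℝ] F) a := by
  -- The chain rule lives at `coordSection u u.proj`, which equals `u` only propositionally;
  -- generalizing the point lets the equation be substituted.
  have h : ∀ u', coordSection u u.proj = u' →
      MDifferentiableAt 𝓘(ℝ, E).tangent 𝓘(ℝ, F) f u' →
      (mfderiv 𝓘(ℝ, E).tangent 𝓘(ℝ, F) f u' : E × E →L[ℝ] F)
        ((mfderiv 𝓘(ℝ, E) 𝓘(ℝ, E).tangent (coordSection u) u.proj : E →L[ℝ] E × E) a) =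
      (mfderiv 𝓘(ℝ, E) 𝓘(ℝ, F) (f ∘ coordSection u) u.proj : E →L[ℝ] F) a := by
    rintro _ rfl hf
    rw [mfderiv_comp u.proj hf (mdifferentiableAt_coordSection u)]
    rfl
  exact h u (coordSection_self u) hf

@[simp] lemma dproj_coordLift (u : TM E M) (a : TanM (E := E) u.proj) :
    dproj u (coordLift u a) = a := by
  rw [← tderiv_baseCoord_self, tderiv_coordLift
    (mdifferentiableAt_baseCoord (mem_chart_source E u.proj))]
  exact chartDeriv_self u.proj a

@[simp] lemma dfibre_coordLift (u : TM E M) (a : TanM (E := E) u.proj) :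
    dfibre u (coordLift u a) = 0 := by
  rw [← tderiv_fibreCoord_self, tderiv_coordLift
    (mdifferentiableAt_fibreCoord (mem_chart_source E u.proj))]
  have h : fibreCoord u.proj ∘ coordSection u =ᶠ[𝓝 u.proj] fun _ ↦ (u.snd : E) := by
    filter_upwards [(chartAt E u.proj).open_source.mem_nhds (mem_chart_source E u.proj)] with q hq
    exact fibreCoord_coordSection hq
  have h1 := h.mfderiv_eq (I := 𝓘(ℝ, E)) (I' := 𝓘(ℝ, E))
  have h2 := mfderiv_const (I := 𝓘(ℝ, E)) (I' := 𝓘(ℝ, E)) (M' := E) (c := u.snd) (x := u.proj)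
  exact congrArg (fun A : E →L[ℝ] E ↦ A a) (h1.trans h2)

@[simp] lemma dproj_horLift (g : Metric E M) (u : TM E M) (a : TanM (E := E) u.proj) :
    dproj u (horLift g u a) = a := by
  simp [horLift]

@[simp] lemma dfibre_horLift (g : Metric E M) (u : TM E M) (a : TanM (E := E) u.proj) :
    dfibre u (horLift g u a) = - christoffel g u.proj a u.snd := by
  simp [horLift]

lemma connector_horLift (g : Metric E M) (u : TM E M) (a : TanM (E := E) u.proj) :
    connector g u (horLift g u a) = 0 := by
  simp [connector]

lemma eq_horLift_of_isHorizontal {g : Metric E M} {u : TM E M} {w : TanTM u}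
    (h : IsHorizontal g w) : w = horLift g u (dproj u w) := by
  refine tanTM_ext (by simp) ?_
  rw [dfibre_horLift]
  exact eq_neg_of_add_eq_zero_left h

@[simp] lemma dproj_mirror (u : TM E M) (w : TanTM u) : dproj u (mirror u w) = 0 := by
  simp [mirror]

@[simp] lemma dfibre_mirror (u : TM E M) (w : TanTM u) : dfibre u (mirror u w) = dproj u w := by
  simp [mirror]

/-! ### The Lie bracket on a manifold in chart components -/

section LieBracket

variable {B : Type*} [NormedAddCommGroup B] [NormedSpace ℝ B]
  {H : Type*} [TopologicalSpace H] {J : ModelWithCorners ℝ B H} [J.Boundaryless]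
  {N : Type*} [TopologicalSpace N] [ChartedSpace H N] [IsManifold J 1 N]

/-- The expression of a vector field in the preferred chart at `x₀`. -/
def chartField (J : ModelWithCorners ℝ B H) (x₀ : N) (V : ∀ x : N, TangentSpace J x) (x : N) : B :=
  (mfderiv J 𝓘(ℝ, B) (extChartAt J x₀) x : TangentSpace J x →L[ℝ] B) (V x)

/-- The derivative of a map from a manifold to a vector space. -/
def vderiv {F : Type*} [NormedAddCommGroup F] [NormedSpace ℝ F] (J : ModelWithCorners ℝ B H)
    (f : N → F) (x : N) : TangentSpace J x →L[ℝ] F :=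
  mfderiv J 𝓘(ℝ, F) f x

omit [J.Boundaryless] in
lemma trivializationAt_snd_eq_vderiv {x₀ x : N} (hx : x ∈ (chartAt H x₀).source)
    (w : TangentSpace J x) :
    (trivializationAt B (TangentSpace J) x₀ (⟨x, w⟩ : TangentBundle J N)).2 =
      vderiv J (extChartAt J x₀) x w := by
  unfold vderiv
  rw [← TangentBundle.continuousLinearMapAt_trivializationAt (I := J) hx,
    Bundle.Trivialization.continuousLinearMapAt_apply,
    Bundle.Trivialization.coe_linearMapAt_of_mem _ (by simpa using hx)]

/-- The bracket is defined by transport through the chart at `x₀`, whose differential at `x₀` is the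
identity. Hence at that one point the flat formula holds with no correction, and only
differentiability of the components is needed. -/
lemma mlieBracket_eq_chartField {V W : ∀ x : N, TangentSpace J x} {x₀ : N}
    (hV : MDifferentiableAt J 𝓘(ℝ, B) (chartField J x₀ V) x₀)
    (hW : MDifferentiableAt J 𝓘(ℝ, B) (chartField J x₀ W) x₀) :
    mlieBracket J V W x₀ =
      vderiv J (chartField J x₀ W) x₀ (V x₀) - vderiv J (chartField J x₀ V) x₀ (W x₀) := by
  have key (V : ∀ x : N, TangentSpace J x) :
      mpullbackWithin 𝓘(ℝ, B) J (extChartAt J x₀).symm V (Set.range J) =ᶠ[𝓝 (extChartAt J x₀ x₀)]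
        fun z ↦ chartField J x₀ V ((extChartAt J x₀).symm z) := by
    filter_upwards [extChartAt_target_mem_nhds x₀] with z hz
    rw [mpullbackWithin_apply]
    unfold chartField
    have h1 := mfderiv_extChartAt_comp_mfderivWithin_extChartAt_symm (I := J) hz
    have h2 := mfderivWithin_extChartAt_symm_comp_mfderiv_extChartAt (I := J) hz
    rw [ContinuousLinearMap.inverse_eq h2 h1]
    rfl
  have hfd (V : ∀ x : N, TangentSpace J x) (hV : MDifferentiableAt J 𝓘(ℝ, B) (chartField J x₀ V) x₀)
      (w : B) :
      fderiv ℝ (fun z ↦ chartField J x₀ V ((extChartAt J x₀).symm z)) (extChartAt J x₀ x₀) w =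
        vderiv J (chartField J x₀ V) x₀ w := by
    unfold vderiv
    rw [hV.mfderiv, J.range_eq_univ, fderivWithin_univ]
    rfl
  have hself (V : ∀ x : N, TangentSpace J x) : chartField J x₀ V x₀ = V x₀ := by
    unfold chartField
    rw [mfderiv_extChartAt_self]
    rfl
  have hinv (z : B) : ((mfderiv J 𝓘(ℝ, B) (extChartAt J x₀) x₀).inverse z : B) = z := by
    have h1 : (mfderiv J 𝓘(ℝ, B) (extChartAt J x₀) x₀ : B →L[ℝ] B) = ContinuousLinearMap.id ℝ B :=
      mfderiv_extChartAt_self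
    exact congrArg (fun A : B →L[ℝ] B ↦ A z)
      ((congrArg (fun A : B →L[ℝ] B ↦ A.inverse) h1).trans ContinuousLinearMap.inverse_id)
  have hs : (extChartAt J x₀).symm ⁻¹' Set.univ ∩ Set.range J = Set.univ := by
    rw [Set.preimage_univ, Set.univ_inter, J.range_eq_univ]
  have hb (f f' F F' : B → B) (z : B) (s : Set B) (hs : s = Set.univ) (h : f =ᶠ[𝓝 z] F)
      (h' : f' =ᶠ[𝓝 z] F') :
      lieBracketWithin ℝ f f' s z = fderiv ℝ F' z (F z) - fderiv ℝ F z (F' z) := by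
    rw [hs, lieBracketWithin_univ, h.lieBracket_vectorField_eq h']
    rfl
  refine (hinv _).trans ((hb _ _ _ _ _ _ hs (key V) (key W)).trans ?_)
  rw [hfd V hV, hfd W hW, (extChartAt J x₀).left_inv (mem_extChartAt_source x₀), hself, hself]

end LieBracket

/-! ### Vector fields on `TM` in coordinates -/

/-- The base component of a vector field on `TM` in the coordinates of `TM` induced by the
preferred chart at `p`. -/
def baseComp (p : M) (X : ∀ u : TM E M, TanTM u) (u : TM E M) : E :=
  tderiv (baseCoord p) u (X u)

/-- The fibre component of a vector field on `TM` in the coordinates of `TM` induced by the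
preferred chart at `p`. -/
def fibreComp (p : M) (X : ∀ u : TM E M, TanTM u) (u : TM E M) : E :=
  tderiv (fibreCoord p) u (X u)

lemma baseComp_self (X : ∀ u : TM E M, TanTM u) (u : TM E M) :
    baseComp u.proj X u = dproj u (X u) := tderiv_baseCoord_self u (X u)

lemma eventually_chart_at (u : TM E M) : ∀ᶠ u' in 𝓝 u, u'.proj ∈ (chartAt E u.proj).source :=
  eventually_mem_chart_source (mem_chart_source E u.proj)

lemma chartField_tangentBundle_eventuallyEq (X : ∀ u : TM E M, TanTM u) (u : TM E M) :
    chartField 𝓘(ℝ, E).tangent u X =ᶠ[𝓝 u]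
      fun u' ↦ (baseComp u.proj X u', fibreComp u.proj X u') := by
  filter_upwards [eventually_chart_at u] with u' h
  exact mfderiv_extChartAt_tangentBundle h (X u')

/-- A vector field on `TM` with differentiable components at `u`. -/
def DifferentiableFieldAt (X : ∀ u : TM E M, TanTM u) (u : TM E M) : Prop :=
  MDifferentiableAt 𝓘(ℝ, E).tangent 𝓘(ℝ, E) (baseComp u.proj X) u ∧
    MDifferentiableAt 𝓘(ℝ, E).tangent 𝓘(ℝ, E) (fibreComp u.proj X) u

/-- The trivialization of `TTM` is the differential of the chart of `TM`, and this chart is the pair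
of base and fibre coordinates. -/
lemma SmoothFieldAtTM.contMDiffAt_comp {X : ∀ u : TM E M, TanTM u} {u : TM E M}
    (h : SmoothFieldAtTM X u) :
    ContMDiffAt 𝓘(ℝ, E).tangent 𝓘(ℝ, E) ∞ (baseComp u.proj X) u ∧
      ContMDiffAt 𝓘(ℝ, E).tangent 𝓘(ℝ, E) ∞ (fibreComp u.proj X) u := by
  have h1 := (Bundle.contMDiffAt_section (IB := 𝓘(ℝ, E).tangent) (n := ∞) (s := X) u).1 h
  have h2 : (fun u' ↦ (trivializationAt (E × E) (TangentSpace 𝓘(ℝ, E).tangent) u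
      (⟨u', X u'⟩ : TangentBundle 𝓘(ℝ, E).tangent (TM E M))).2) =ᶠ[𝓝 u]
      fun u' ↦ (baseComp u.proj X u', fibreComp u.proj X u') := by
    filter_upwards [eventually_chart_at u] with u' h
    refine Eq.trans ?_ (mfderiv_extChartAt_tangentBundle h (X u'))
    have hu : u' ∈ (chartAt (ModelProd E E) u).source := by simpa using h
    exact trivializationAt_snd_eq_vderiv hu (X u')
  have h3 := h1.congr_of_eventuallyEq h2.symm
  exact ⟨(contDiff_fst (𝕜 := ℝ) (E := E) (F := E)).contMDiff.contMDiffAt.comp u h3,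
    (contDiff_snd (𝕜 := ℝ) (E := E) (F := E)).contMDiff.contMDiffAt.comp u h3⟩

lemma SmoothFieldAtTM.differentiableFieldAt {X : ∀ u : TM E M, TanTM u} {u : TM E M}
    (h : SmoothFieldAtTM X u) : DifferentiableFieldAt X u :=
  ⟨h.contMDiffAt_comp.1.mdifferentiableAt (by decide),
    h.contMDiffAt_comp.2.mdifferentiableAt (by decide)⟩

lemma mlieBracket_tangentBundle {X Y : ∀ u : TM E M, TanTM u} {u : TM E M}
    (hX : DifferentiableFieldAt X u) (hY : DifferentiableFieldAt Y u) :
    dproj u (mlieBracket 𝓘(ℝ, E).tangent X Y u) =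
        tderiv (baseComp u.proj Y) u (X u) - tderiv (baseComp u.proj X) u (Y u) ∧
      dfibre u (mlieBracket 𝓘(ℝ, E).tangent X Y u) =
        tderiv (fibreComp u.proj Y) u (X u) - tderiv (fibreComp u.proj X) u (Y u) := by
  have hd (X : ∀ u : TM E M, TanTM u) (hX : DifferentiableFieldAt X u) (w : TanTM u) :
      vderiv 𝓘(ℝ, E).tangent (chartField 𝓘(ℝ, E).tangent u X) u w =
        (tderiv (baseComp u.proj X) u w, tderiv (fibreComp u.proj X) u w) := by
    rw [← tderiv_prodMk hX.1 hX.2, ← tderiv_congr (chartField_tangentBundle_eventuallyEq X u)]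
    rfl
  have hm (X : ∀ u : TM E M, TanTM u) (hX : DifferentiableFieldAt X u) :
      MDifferentiableAt 𝓘(ℝ, E).tangent 𝓘(ℝ, E × E) (chartField 𝓘(ℝ, E).tangent u X) u :=
    (chartField_tangentBundle_eventuallyEq X u).mdifferentiableAt_iff.2 (hX.1.prodMk_space hX.2)
  have h := mlieBracket_eq_chartField (hm X hX) (hm Y hY)
  rw [hd X hX, hd Y hY] at h
  have h' := (tanTM_eq_prod (mlieBracket 𝓘(ℝ, E).tangent X Y u)).symm.trans h
  exact Prod.ext_iff.1 h'

lemma baseComp_mirror_eventuallyEq (Y : ∀ u : TM E M, TanTM u) (u : TM E M) :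
    baseComp u.proj (fun u' ↦ mirror u' (Y u')) =ᶠ[𝓝 u] fun _ ↦ 0 := by
  filter_upwards [eventually_chart_at u] with u' h
  rw [baseComp, tderiv_baseCoord h, dproj_mirror, map_zero]

/-- With the preceding lemma: `B` has constant coefficients in induced coordinates, and this on a
whole neighbourhood, so the identity may be differentiated. -/
lemma fibreComp_mirror_eventuallyEq (Y : ∀ u : TM E M, TanTM u) (u : TM E M) :
    fibreComp u.proj (fun u' ↦ mirror u' (Y u')) =ᶠ[𝓝 u] baseComp u.proj Y := by
  filter_upwards [eventually_chart_at u] with u' h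
  rw [fibreComp, baseComp, tderiv_baseCoord h]
  exact tderiv_fibreCoord_vertLift h _

lemma DifferentiableFieldAt.mirror {Y : ∀ u : TM E M, TanTM u} {u : TM E M}
    (h : DifferentiableFieldAt Y u) : DifferentiableFieldAt (fun u' ↦ mirror u' (Y u')) u :=
  ⟨(baseComp_mirror_eventuallyEq Y u).mdifferentiableAt_iff.2 mdifferentiableAt_const,
    (fibreComp_mirror_eventuallyEq Y u).mdifferentiableAt_iff.2 h.1⟩

/-- The term `∂_X Y¹` occurs both in the fibre part of `[X, BY]` and in `B[X, Y]`, and cancels. The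
result depends on `Y` only through its value at `u`. -/
lemma lieDerivEnd_mirror {X Y : ∀ u : TM E M, TanTM u} {u : TM E M}
    (hX : DifferentiableFieldAt X u) (hY : DifferentiableFieldAt Y u) :
    dproj u (lieDerivEnd mirror X Y u) = - tderiv (baseComp u.proj X) u (mirror u (Y u)) ∧
      dfibre u (lieDerivEnd mirror X Y u) =
        tderiv (baseComp u.proj X) u (Y u) - tderiv (fibreComp u.proj X) u (mirror u (Y u)) := by
  obtain ⟨h1, -⟩ := mlieBracket_tangentBundle hX hY
  obtain ⟨h3, h4⟩ := mlieBracket_tangentBundle hX hY.mirror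
  rw [tderiv_congr (baseComp_mirror_eventuallyEq Y u), tderiv_const] at h3
  rw [tderiv_congr (fibreComp_mirror_eventuallyEq Y u)] at h4
  unfold lieDerivEnd
  rw [map_sub, map_sub, dproj_mirror, dfibre_mirror, h1, h3, h4]
  constructor
  · exact (sub_zero _).trans (zero_sub _)
  · abel

/-! ### Christoffel symbols on vector spaces -/

section Calculus

set_option maxSynthPendingDepth 3

variable {V : Type*} [NormedAddCommGroup V] [NormedSpace ℝ V]

/-- The Christoffel symbols of the first kind of a field `G` of bilinear forms on a vector space. -/
def christoffelForm (G : V → V →L[ℝ] V →L[ℝ] ℝ) (e : V) : V →L[ℝ] V →L[ℝ] V →L[ℝ] ℝ :=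
  (1 / 2 : ℝ) • (fderiv ℝ G e + (fderiv ℝ G e).flip -
    (ContinuousLinearMap.flipₗᵢ ℝ V V ℝ : (V →L[ℝ] V →L[ℝ] ℝ) →L[ℝ] V →L[ℝ] V →L[ℝ] ℝ).comp
      (fderiv ℝ G e).flip)

lemma christoffelForm_apply (G : V → V →L[ℝ] V →L[ℝ] ℝ) (e a b c : V) :
    christoffelForm G e a b c =
      (1 / 2 : ℝ) * (fderiv ℝ G e a b c + fderiv ℝ G e b a c - fderiv ℝ G e c a b) := rfl

/-- The Christoffel symbols of the second kind of a field `G` of bilinear forms on a vector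
space. -/
def christoffelMap (G : V → V →L[ℝ] V →L[ℝ] ℝ) (e : V) : V →L[ℝ] V →L[ℝ] V :=
  (ContinuousLinearMap.compL ℝ V (V →L[ℝ] ℝ) V (G e).inverse).comp (christoffelForm G e)

lemma christoffelMap_apply (G : V → V →L[ℝ] V →L[ℝ] ℝ) (e a b : V) :
    christoffelMap G e a b = (G e).inverse (christoffelForm G e a b) := rfl

lemma apply_christoffelMap {G : V → V →L[ℝ] V →L[ℝ] ℝ} {e : V} (h : (G e).IsInvertible)
    (a b : V) : G e (christoffelMap G e a b) = christoffelForm G e a b := by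
  rw [christoffelMap_apply, h.self_apply_inverse]

lemma fderiv_bilin_apply {G : V → V →L[ℝ] V →L[ℝ] ℝ} {e : V} (hG : DifferentiableAt ℝ G e)
    (a b c : V) : fderiv ℝ (fun x ↦ G x a b) e c = fderiv ℝ G e c a b := by
  have := (hG.hasFDerivAt.clm_apply (hasFDerivAt_const a e)).clm_apply (hasFDerivAt_const b e)
  rw [this.fderiv]
  simp

lemma fderiv_bilin_symm {G : V → V →L[ℝ] V →L[ℝ] ℝ} {e : V} (hG : DifferentiableAt ℝ G e)
    (hs : ∀ᶠ x in 𝓝 e, ∀ a b, G x a b = G x b a) (a b c : V) :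
    fderiv ℝ G e c a b = fderiv ℝ G e c b a := by
  rw [← fderiv_bilin_apply hG, ← fderiv_bilin_apply hG]
  congr 1
  apply Filter.EventuallyEq.fderiv_eq
  filter_upwards [hs] with x hx using hx a b

/-- Vanishing of torsion: the first two terms of the Christoffel form are exchanged, and the third
is symmetric because the metric is. -/
lemma christoffelMap_symm {G : V → V →L[ℝ] V →L[ℝ] ℝ} {e : V} (hG : DifferentiableAt ℝ G e)
    (hs : ∀ᶠ x in 𝓝 e, ∀ a b, G x a b = G x b a) (a b : V) :
    christoffelMap G e a b = christoffelMap G e b a := by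
  rw [christoffelMap_apply, christoffelMap_apply]
  congr 1
  ext c
  rw [christoffelForm_apply, christoffelForm_apply, fderiv_bilin_symm hG hs a b c]
  ring

lemma differentiableAt_christoffelForm {G : V → V →L[ℝ] V →L[ℝ] ℝ} {e : V}
    (hG : ContDiffAt ℝ 2 G e) : DifferentiableAt ℝ (christoffelForm G) e := by
  have h : DifferentiableAt ℝ (fderiv ℝ G) e :=
    (hG.fderiv_right (m := 1) (by norm_num)).differentiableAt one_ne_zero
  have h' : DifferentiableAt ℝ (fun x ↦ (fderiv ℝ G x).flip) e :=
    (ContinuousLinearMap.flipₗᵢ ℝ V V (V →L[ℝ] ℝ)).toContinuousLinearEquiv.differentiableAt.comp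
      e h
  exact ((h.add h').sub ((differentiableAt_const _).clm_comp h')).const_smul (1 / 2 : ℝ)

lemma differentiableAt_christoffelMap [CompleteSpace V] {G : V → V →L[ℝ] V →L[ℝ] ℝ} {e : V}
    (hG : ContDiffAt ℝ 2 G e) (hi : (G e).IsInvertible) :
    DifferentiableAt ℝ (christoffelMap G) e := by
  have h : DifferentiableAt ℝ (fun x ↦ (G x).inverse) e :=
    ((hi.contDiffAt_map_inverse (n := 1)).differentiableAt one_ne_zero).comp e
      (hG.differentiableAt (by norm_num))
  exact ((ContinuousLinearMap.compL ℝ V (V →L[ℝ] ℝ) V).differentiableAt.comp e h).clm_comp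
    (differentiableAt_christoffelForm hG)

/-- The derivative of the pull-back of a field of bilinear forms. -/
lemma fderiv_pullback_bilin {G H : V → V →L[ℝ] V →L[ℝ] ℝ} {τ : V → V} {e : V}
    (hτ : ContDiffAt ℝ 2 τ e) (hG : DifferentiableAt ℝ G (τ e)) (hH : DifferentiableAt ℝ H e)
    (h : ∀ᶠ x in 𝓝 e, ∀ a b, H x a b = G (τ x) (fderiv ℝ τ x a) (fderiv ℝ τ x b)) (a b c : V) :
    fderiv ℝ H e c a b =
      fderiv ℝ G (τ e) (fderiv ℝ τ e c) (fderiv ℝ τ e a) (fderiv ℝ τ e b)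
        + G (τ e) (fderiv ℝ (fderiv ℝ τ) e c a) (fderiv ℝ τ e b)
        + G (τ e) (fderiv ℝ τ e a) (fderiv ℝ (fderiv ℝ τ) e c b) := by
  have h1 : (fun x ↦ H x a b) =ᶠ[𝓝 e] fun x ↦ G (τ x) (fderiv ℝ τ x a) (fderiv ℝ τ x b) := by
    filter_upwards [h] with x hx using hx a b
  have h2 : HasFDerivAt (fderiv ℝ τ) (fderiv ℝ (fderiv ℝ τ) e) e :=
    ((hτ.fderiv_right (m := 1) (by norm_num)).differentiableAt one_ne_zero).hasFDerivAt
  have h3 : HasFDerivAt τ (fderiv ℝ τ e) e := (hτ.differentiableAt (by norm_num)).hasFDerivAt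
  have h4 := ((hG.hasFDerivAt.comp e h3).clm_apply (h2.clm_apply (hasFDerivAt_const a e))).clm_apply
    (h2.clm_apply (hasFDerivAt_const b e))
  have h5 := (h4.congr_of_eventuallyEq h1).fderiv
  rw [← fderiv_bilin_apply hH, h5]
  simp
  ring

/-- The transformation law of the Christoffel symbols under a change of coordinates. -/
lemma christoffelMap_change {G H : V → V →L[ℝ] V →L[ℝ] ℝ} {τ : V → V} {e : V}
    (hτ : ContDiffAt ℝ 2 τ e) (hG : DifferentiableAt ℝ G (τ e)) (hH : DifferentiableAt ℝ H e)
    (h : ∀ᶠ x in 𝓝 e, ∀ a b, H x a b = G (τ x) (fderiv ℝ τ x a) (fderiv ℝ τ x b))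
    (hs : ∀ᶠ x in 𝓝 (τ e), ∀ a b, G x a b = G x b a)
    (hGi : (G (τ e)).IsInvertible) (hHi : (H e).IsInvertible)
    (hsurj : Function.Surjective (fderiv ℝ τ e)) (a b : V) :
    fderiv ℝ τ e (christoffelMap H e a b) =
      christoffelMap G (τ e) (fderiv ℝ τ e a) (fderiv ℝ τ e b)
        + fderiv ℝ (fderiv ℝ τ) e a b := by
  -- Lower the index with `G`. Since `dτ` is surjective, it suffices to test on vectors `dτ c`,
  -- where pairings under `G` become pairings under `H`.
  apply hGi.injective
  ext c
  obtain ⟨c, rfl⟩ := hsurj c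
  -- Symmetry of the second derivative cancels four of the six second-order terms; the other two add
  -- up to `G (D²τ (a, b), dτ c)`.
  have hsymm (a b : V) : fderiv ℝ (fderiv ℝ τ) e a b = fderiv ℝ (fderiv ℝ τ) e b a :=
    hτ.isSymmSndFDerivAt (by simp) a b
  have hs' := hs.self_of_nhds
  rw [← h.self_of_nhds, apply_christoffelMap hHi, map_add, add_apply,
    apply_christoffelMap hGi, christoffelForm_apply, christoffelForm_apply,
    fderiv_pullback_bilin hτ hG hH h, fderiv_pullback_bilin hτ hG hH h,
    fderiv_pullback_bilin hτ hG hH h, hsymm b a, hsymm c a, hsymm c b,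
    hs' (fderiv ℝ τ e b) (fderiv ℝ (fderiv ℝ τ) e a c)]
  ring

end Calculus

/-! ### The metric in charts -/

/-- The change of coordinates from the preferred chart at `q` to the one at `p`. -/
def chartChange (p q : M) : E → E := extChartAt 𝓘(ℝ, E) p ∘ (extChartAt 𝓘(ℝ, E) q).symm

lemma contDiffAt_chartChange {p q : M} {e : E} (he : e ∈ (extChartAt 𝓘(ℝ, E) q).target)
    (h : (extChartAt 𝓘(ℝ, E) q).symm e ∈ (chartAt E p).source) :
    ContDiffAt ℝ ∞ (chartChange p q) e := by
  have := contDiffWithinAt_ext_coord_change (I := 𝓘(ℝ, E)) (n := ∞) p q (y := e)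
    (by rw [PartialEquiv.trans_source]; exact ⟨he, by simpa using h⟩)
  rwa [ModelWithCorners.range_eq_univ, contDiffWithinAt_univ] at this

/-- The derivative at `e` of the inverse of the preferred chart at `p`. -/
def chartSymmDeriv (p : M) (e : E) :
    E →L[ℝ] TanM (E := E) ((extChartAt 𝓘(ℝ, E) p).symm e) :=
  mfderiv 𝓘(ℝ, E) 𝓘(ℝ, E) (extChartAt 𝓘(ℝ, E) p).symm e

lemma chartDeriv_chartSymmDeriv {p : M} {e : E} (he : e ∈ (extChartAt 𝓘(ℝ, E) p).target) (a : E) :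
    chartDeriv p ((extChartAt 𝓘(ℝ, E) p).symm e) (chartSymmDeriv p e a) = a := by
  have := mfderiv_extChartAt_comp_mfderivWithin_extChartAt_symm (I := 𝓘(ℝ, E)) he
  rw [ModelWithCorners.range_eq_univ, mfderivWithin_univ] at this
  exact congrArg (fun A : E →L[ℝ] E ↦ A a) this

lemma contMDiffAt_extChartAt_symm {p : M} {e : E} (he : e ∈ (extChartAt 𝓘(ℝ, E) p).target) :
    ContMDiffAt 𝓘(ℝ, E) 𝓘(ℝ, E) ∞ (extChartAt 𝓘(ℝ, E) p).symm e :=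
  (contMDiffOn_extChartAt_symm p).contMDiffAt
    ((isOpen_extChartAt_target p).mem_nhds he)

/-- A coordinate vector field has constant fibre coordinate in its own chart. -/
lemma contMDiffAt_coordField (p : M) {e : E} (he : e ∈ (extChartAt 𝓘(ℝ, E) p).target) (a : E) :
    ContMDiffAt 𝓘(ℝ, E) 𝓘(ℝ, E).tangent ∞
      (fun e ↦ (⟨(extChartAt 𝓘(ℝ, E) p).symm e, chartSymmDeriv p e a⟩ : TM E M)) e := by
  have hs {x : E} (hx : x ∈ (extChartAt 𝓘(ℝ, E) p).target) :
      (extChartAt 𝓘(ℝ, E) p).symm x ∈ (chartAt E p).source := by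
    simpa using (extChartAt 𝓘(ℝ, E) p).map_target hx
  rw [(trivializationAt E (TangentSpace 𝓘(ℝ, E)) p).contMDiffAt_iff (IB := 𝓘(ℝ, E))
    (by simpa using hs he)]
  refine ⟨contMDiffAt_extChartAt_symm he, (contMDiffAt_const (c := a)).congr_of_eventuallyEq ?_⟩
  filter_upwards [(isOpen_extChartAt_target p).mem_nhds he] with x hx
  exact (fibreCoord_eq (p := p) (u := ⟨_, chartSymmDeriv p x a⟩) (hs hx)).trans
    (chartDeriv_chartSymmDeriv hx a)

lemma metricInChart_apply (g : Metric E M) (p : M) (e a b : E) :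
    metricInChart g p e a b = g.inner ((extChartAt 𝓘(ℝ, E) p).symm e)
      (chartSymmDeriv p e a) (chartSymmDeriv p e b) := rfl

lemma metricInChart_symm (g : Metric E M) (p : M) (e a b : E) :
    metricInChart g p e a b = metricInChart g p e b a := by
  rw [metricInChart_apply, metricInChart_apply, g.symm]

lemma metricInChart_self (g : Metric E M) (p : M) :
    metricInChart g p (extChartAt 𝓘(ℝ, E) p p) = (g.inner p : E →L[ℝ] E →L[ℝ] ℝ) := by
  have h (q : M) (hq : q = p) (A : E →L[ℝ] E) (hA : A = ContinuousLinearMap.id ℝ E) :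
      let G : E →L[ℝ] E →L[ℝ] ℝ := g.inner q
      G.bilinearComp A A = (g.inner p : E →L[ℝ] E →L[ℝ] ℝ) := by
    subst hq hA
    rfl
  refine h _ (extChartAt_to_inv p) _ ?_
  have := mfderivWithin_range_extChartAt_symm (I := 𝓘(ℝ, E)) (x := p)
  rw [ModelWithCorners.range_eq_univ, mfderivWithin_univ] at this
  exact this

/-- Positive definiteness makes the map to the dual injective, and in finite dimension the
dimensions agree. -/
lemma isInvertible_metricInChart [FiniteDimensional ℝ E] (g : Metric E M) {p : M} {e : E}
    (he : e ∈ (extChartAt 𝓘(ℝ, E) p).target) : (metricInChart g p e).IsInvertible := by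
  have hinj : Function.Injective (metricInChart g p e : E →ₗ[ℝ] (E →L[ℝ] ℝ)) := by
    rw [injective_iff_map_eq_zero]
    intro a ha
    by_contra hne
    have h0 : chartSymmDeriv p e a ≠ 0 := by
      intro h
      have := chartDeriv_chartSymmDeriv he a
      rw [h, map_zero] at this
      exact hne this.symm
    have h1 := g.pos _ _ h0
    rw [← metricInChart_apply] at h1
    have h2 : metricInChart g p e a = 0 := ha
    rw [h2] at h1
    exact lt_irrefl _ h1
  have hdim : Module.finrank ℝ E = Module.finrank ℝ (E →L[ℝ] ℝ) := by
    rw [← (LinearMap.toContinuousLinearMap (𝕜 := ℝ) (E := E) (F' := ℝ)).finrank_eq]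
    exact (Subspace.dual_finrank_eq).symm
  let L := LinearEquiv.ofInjectiveOfFinrankEq _ hinj hdim
  exact ⟨L.toContinuousLinearEquiv, by ext a b; rfl⟩

/-- In finite dimension it is enough to test on fixed `a`, `b`, and there the value is the smooth
metric evaluated on two smooth coordinate fields. -/
lemma contDiffOn_metricInChart [FiniteDimensional ℝ E] (g : Metric E M) (p : M) :
    ContDiffOn ℝ ∞ (metricInChart g p) (extChartAt 𝓘(ℝ, E) p).target := by
  rw [contDiffOn_clm_apply]
  intro a
  rw [contDiffOn_clm_apply]
  intro b e he
  have h1 := (g.contMDiff ((extChartAt 𝓘(ℝ, E) p).symm e)).comp e (contMDiffAt_extChartAt_symm he)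
  have h2 : ContMDiffAt 𝓘(ℝ, E) (𝓘(ℝ, E).prod 𝓘(ℝ, ℝ)) ∞
      (fun x ↦ (Bundle.TotalSpace.mk' ℝ (E := Bundle.Trivial M ℝ)
        ((extChartAt 𝓘(ℝ, E) p).symm x) (metricInChart g p x a b))) e := by
    apply ContMDiffAt.clm_bundle_apply₂ (F₁ := E) (F₂ := E)
    · exact h1
    · exact contMDiffAt_coordField p he a
    · exact contMDiffAt_coordField p he b
  have h3 := (Bundle.contMDiffAt_totalSpace.1 h2).2
  exact (contMDiffAt_iff_contDiffAt.1 h3).contDiffWithinAt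

lemma chartSymmDeriv_change {p q : M} {e : E} (he : e ∈ (extChartAt 𝓘(ℝ, E) q).target)
    (h : (extChartAt 𝓘(ℝ, E) q).symm e ∈ (chartAt E p).source) :
    (extChartAt 𝓘(ℝ, E) q).symm =ᶠ[𝓝 e] (extChartAt 𝓘(ℝ, E) p).symm ∘ chartChange p q ∧
      ∀ a, (chartSymmDeriv q e : E →L[ℝ] E) a =
        (chartSymmDeriv p (chartChange p q e) : E →L[ℝ] E) (fderiv ℝ (chartChange p q) e a) := by
  have h1 : (extChartAt 𝓘(ℝ, E) q).symm =ᶠ[𝓝 e]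
      (extChartAt 𝓘(ℝ, E) p).symm ∘ chartChange p q := by
    filter_upwards [(contMDiffAt_extChartAt_symm he).continuousAt.eventually
      ((chartAt E p).open_source.mem_nhds h)] with x hx
    exact ((extChartAt 𝓘(ℝ, E) p).left_inv (by rw [extChartAt_source]; exact hx)).symm
  refine ⟨h1, fun a ↦ ?_⟩
  have ht : chartChange p q e ∈ (extChartAt 𝓘(ℝ, E) p).target :=
    (extChartAt 𝓘(ℝ, E) p).map_source (by simpa using h)
  have h2 := mfderiv_comp e ((contMDiffAt_extChartAt_symm ht).mdifferentiableAt (by decide))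
    ((contDiffAt_chartChange he h).differentiableAt (by decide)).mdifferentiableAt
  have h3 : (mfderiv 𝓘(ℝ, E) 𝓘(ℝ, E) (extChartAt 𝓘(ℝ, E) q).symm e : E →L[ℝ] E) =
    mfderiv 𝓘(ℝ, E) 𝓘(ℝ, E) ((extChartAt 𝓘(ℝ, E) p).symm ∘ chartChange p q) e := h1.mfderiv_eq
  rw [mfderiv_eq_fderiv] at h2
  exact congrArg (fun A : E →L[ℝ] E ↦ A a) (h3.trans h2)

lemma metricInChart_change (g : Metric E M) {p q : M} {e : E}
    (he : e ∈ (extChartAt 𝓘(ℝ, E) q).target)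
    (h : (extChartAt 𝓘(ℝ, E) q).symm e ∈ (chartAt E p).source) (a b : E) :
    metricInChart g q e a b = metricInChart g p (chartChange p q e)
      (fderiv ℝ (chartChange p q) e a) (fderiv ℝ (chartChange p q) e b) := by
  obtain ⟨h1, h2⟩ := chartSymmDeriv_change he h
  have key (x y : M) (hxy : x = y) (a a' b b' : E) (ha : a = a') (hb : b = b') :
      (g.inner x : E →L[ℝ] E →L[ℝ] ℝ) a b = (g.inner y : E →L[ℝ] E →L[ℝ] ℝ) a' b' := by
    rw [hxy, ha, hb]
  exact key _ _ h1.self_of_nhds _ _ _ _ (h2 a) (h2 b)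

lemma chartDeriv_change {p q r : M} (hp : r ∈ (chartAt E p).source)
    (hq : r ∈ (chartAt E q).source) (a : TanM (E := E) r) :
    chartDeriv p r a =
      fderiv ℝ (chartChange p q) (extChartAt 𝓘(ℝ, E) q r) (chartDeriv q r a) := by
  have hr : (extChartAt 𝓘(ℝ, E) q).symm (extChartAt 𝓘(ℝ, E) q r) = r :=
    (extChartAt 𝓘(ℝ, E) q).left_inv (by simpa using hq)
  have h1 : (extChartAt 𝓘(ℝ, E) p : M → E) =ᶠ[𝓝 r] chartChange p q ∘ extChartAt 𝓘(ℝ, E) q := by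
    filter_upwards [(chartAt E q).open_source.mem_nhds hq] with x hx
    show _ = extChartAt 𝓘(ℝ, E) p ((extChartAt 𝓘(ℝ, E) q).symm (extChartAt 𝓘(ℝ, E) q x))
    rw [(extChartAt 𝓘(ℝ, E) q).left_inv (by simpa using hx)]
  have hc := contDiffAt_chartChange (p := p) (q := q) (e := extChartAt 𝓘(ℝ, E) q r)
    ((extChartAt 𝓘(ℝ, E) q).map_source (by simpa using hq)) (by rwa [hr])
  have h2 := mfderiv_comp r (hc.differentiableAt (by decide)).mdifferentiableAt
    (mdifferentiableAt_extChartAt (I := 𝓘(ℝ, E)) hq)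
  rw [mfderiv_eq_fderiv] at h2
  have h3 : (mfderiv 𝓘(ℝ, E) 𝓘(ℝ, E) (extChartAt 𝓘(ℝ, E) p) r : E →L[ℝ] E) =
    mfderiv 𝓘(ℝ, E) 𝓘(ℝ, E) (chartChange p q ∘ extChartAt 𝓘(ℝ, E) q) r := h1.mfderiv_eq
  exact congrArg (fun A : E →L[ℝ] E ↦ A a) (h3.trans h2)

/-! ### The connection map in charts -/

/-- Links the pointwise symbol, built from the chart centred at `p`, with the field of symbols on a
chart target, which can be differentiated. -/
lemma christoffel_eq_christoffelMap (g : Metric E M) (p : M) (a b : TanM (E := E) p) :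
    christoffel g p a b =
      christoffelMap (metricInChart g p) (extChartAt 𝓘(ℝ, E) p p) a b := by
  have h (G : E →L[ℝ] E →L[ℝ] ℝ) (a b : E) (hG : metricInChart g p (extChartAt 𝓘(ℝ, E) p p) = G) :
      G.inverse (christoffelFirst g p a b) =
        christoffelMap (metricInChart g p) (extChartAt 𝓘(ℝ, E) p p) a b := by
    rw [christoffelMap_apply, hG]
    rfl
  exact h _ a b (metricInChart_self g p)

/-- The Christoffel symbols in the preferred chart at `p`, at the point `e` of its target. -/
def christoffelIn (g : Metric E M) (p : M) (e : E) : E →L[ℝ] E →L[ℝ] E :=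
  christoffelMap (metricInChart g p) e

/-- The transition of fibre coordinates is the derivative of the chart change. It varies with the
base point, so differentiating it produces the second derivative of the chart change. -/
lemma fibreCoord_eventuallyEq {p : M} {u : TM E M} (h : u.proj ∈ (chartAt E p).source) :
    fibreCoord p =ᶠ[𝓝 u]
      fun u' ↦ fderiv ℝ (chartChange p u.proj) (baseCoord u.proj u') (fibreCoord u.proj u') := by
  filter_upwards [eventually_mem_chart_source h, eventually_chart_at u] with u' h1 h2
  rw [fibreCoord_eq h1, chartDeriv_change h1 h2, fibreCoord_eq h2]
  rfl

section

variable [FiniteDimensional ℝ E]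

lemma contDiffAt_metricInChart (g : Metric E M) {p : M} {e : E}
    (he : e ∈ (extChartAt 𝓘(ℝ, E) p).target) : ContDiffAt ℝ ∞ (metricInChart g p) e :=
  (contDiffOn_metricInChart g p).contDiffAt ((isOpen_extChartAt_target p).mem_nhds he)

lemma differentiableAt_christoffelIn (g : Metric E M) {p : M} {e : E}
    (he : e ∈ (extChartAt 𝓘(ℝ, E) p).target) : DifferentiableAt ℝ (christoffelIn g p) e :=
  have := FiniteDimensional.complete ℝ E
  differentiableAt_christoffelMap ((contDiffAt_metricInChart g he).of_le (by decide))
    (isInvertible_metricInChart g he)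

lemma christoffelIn_symm (g : Metric E M) {p : M} {e : E}
    (he : e ∈ (extChartAt 𝓘(ℝ, E) p).target) (a b : E) :
    christoffelIn g p e a b = christoffelIn g p e b a :=
  christoffelMap_symm ((contDiffAt_metricInChart g he).differentiableAt (by decide))
    (.of_forall fun x ↦ metricInChart_symm g p x) a b

/-- The transformation law of the Christoffel symbols of a Riemannian metric. -/
lemma christoffelIn_change (g : Metric E M) {p q : M} (h : q ∈ (chartAt E p).source) (a b : E) :
    fderiv ℝ (chartChange p q) (extChartAt 𝓘(ℝ, E) q q)
        (christoffelIn g q (extChartAt 𝓘(ℝ, E) q q) a b) =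
      christoffelIn g p (extChartAt 𝓘(ℝ, E) p q)
          (fderiv ℝ (chartChange p q) (extChartAt 𝓘(ℝ, E) q q) a)
          (fderiv ℝ (chartChange p q) (extChartAt 𝓘(ℝ, E) q q) b)
        + fderiv ℝ (fderiv ℝ (chartChange p q)) (extChartAt 𝓘(ℝ, E) q q) a b := by
  have he := mem_extChartAt_target (I := 𝓘(ℝ, E)) q
  have hq : (extChartAt 𝓘(ℝ, E) q).symm (extChartAt 𝓘(ℝ, E) q q) ∈ (chartAt E p).source := by
    rwa [extChartAt_to_inv]
  have hτ : chartChange p q (extChartAt 𝓘(ℝ, E) q q) = extChartAt 𝓘(ℝ, E) p q := by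
    rw [chartChange, Function.comp_apply, extChartAt_to_inv]
  have ht : extChartAt 𝓘(ℝ, E) p q ∈ (extChartAt 𝓘(ℝ, E) p).target :=
    (extChartAt 𝓘(ℝ, E) p).map_source (by rwa [extChartAt_source])
  have hsurj : Function.Surjective (fderiv ℝ (chartChange p q) (extChartAt 𝓘(ℝ, E) q q)) := by
    intro c
    obtain ⟨a, ha⟩ := (isInvertible_mfderiv_extChartAt (I := 𝓘(ℝ, E)) (x := p) (y := q)
      (by rwa [extChartAt_source])).surjective c
    refine ⟨a, Eq.trans ?_ ha⟩
    have := chartDeriv_change h (mem_chart_source E q) a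
    rw [chartDeriv_self] at this
    exact this.symm
  rw [← hτ] at ht ⊢
  refine christoffelMap_change ((contDiffAt_chartChange he hq).of_le (by decide))
    ((contDiffAt_metricInChart g ht).differentiableAt (by decide))
    ((contDiffAt_metricInChart g he).differentiableAt (by decide)) ?_
    (.of_forall fun x ↦ metricInChart_symm g p x) (isInvertible_metricInChart g ht)
    (isInvertible_metricInChart g he) hsurj a b
  filter_upwards [(isOpen_extChartAt_target q).mem_nhds he,
    (contMDiffAt_extChartAt_symm he).continuousAt.eventually
      ((chartAt E p).open_source.mem_nhds hq)] with x hx hx'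
  exact fun a b ↦ metricInChart_change g hx hx' a b

/-- The connection map in the coordinates of `TM` induced by the preferred chart at `p`. -/
lemma chartDeriv_connector (g : Metric E M) {p : M} {u : TM E M}
    (h : u.proj ∈ (chartAt E p).source) (w : TanTM u) :
    chartDeriv p u.proj (connector g u w) = tderiv (fibreCoord p) u w +
      christoffelIn g p (baseCoord p u) (tderiv (baseCoord p) u w) (fibreCoord p u) := by
  have hs := mem_chart_source E u.proj
  have he := mem_extChartAt_target (I := 𝓘(ℝ, E)) u.proj
  have hτ : ContDiffAt ℝ ∞ (chartChange p u.proj) (baseCoord u.proj u) :=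
    contDiffAt_chartChange he (by rw [baseCoord, extChartAt_to_inv]; exact h)
  have hτ' : DifferentiableAt ℝ (fderiv ℝ (chartChange p u.proj)) (baseCoord u.proj u) :=
    (hτ.fderiv_right (m := 1) (by decide)).differentiableAt one_ne_zero
  have hb := mdifferentiableAt_baseCoord hs
  have hc (a : TanM (E := E) u.proj) : chartDeriv p u.proj a =
      fderiv ℝ (chartChange p u.proj) (baseCoord u.proj u) a := by
    have := chartDeriv_change h hs a
    rwa [chartDeriv_self] at this
  have hf : fibreCoord u.proj u = u.snd := (fibreCoord_eq hs).trans (chartDeriv_self _ _)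
  have h1 : tderiv (fibreCoord p) u w =
      fderiv ℝ (fderiv ℝ (chartChange p u.proj)) (baseCoord u.proj u) (dproj u w) u.snd +
        fderiv ℝ (chartChange p u.proj) (baseCoord u.proj u) (dfibre u w) := by
    rw [tderiv_congr (fibreCoord_eventuallyEq h),
      tderiv_clm_apply (A := fun u' ↦ fderiv ℝ (chartChange p u.proj) (baseCoord u.proj u'))
        (hτ'.mdifferentiableAt.comp u hb) (mdifferentiableAt_fibreCoord hs),
      tderiv_comp hτ' hb, tderiv_baseCoord_self, tderiv_fibreCoord_self, hf]
  have h2 : fibreCoord p u = fderiv ℝ (chartChange p u.proj) (baseCoord u.proj u) u.snd :=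
    (fibreCoord_eq h).trans (hc _)
  have h3 := (tderiv_baseCoord h w).trans (hc (dproj u w))
  have key (x y v k : E) (hk : k = x + christoffelIn g u.proj (baseCoord u.proj u) y v) :
      fderiv ℝ (chartChange p u.proj) (baseCoord u.proj u) k =
        fderiv ℝ (fderiv ℝ (chartChange p u.proj)) (baseCoord u.proj u) y v +
          fderiv ℝ (chartChange p u.proj) (baseCoord u.proj u) x +
        christoffelIn g p (baseCoord p u)
          (fderiv ℝ (chartChange p u.proj) (baseCoord u.proj u) y)
          (fderiv ℝ (chartChange p u.proj) (baseCoord u.proj u) v) := by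
    -- The second-derivative term coming from the fibre coordinate is the inhomogeneous term of the
    -- transformation law.
    have := christoffelIn_change g h y v
    unfold baseCoord at *
    rw [hk, map_add, this]
    abel
  rw [h1, h2, h3]
  exact (hc _).trans (key (dfibre u w) (dproj u w) u.snd _
    (congrArg (@HAdd.hAdd E E E _ (dfibre u w)) (christoffel_eq_christoffelMap g _ _ _)))

end

/-! ### The Lie derivative of the mirror map -/

lemma fibreCoord_self (u : TM E M) : fibreCoord u.proj u = u.snd :=
  (fibreCoord_eq (mem_chart_source E u.proj)).trans (chartDeriv_self _ _)

lemma dproj_mfderiv {B H N : Type*} [NormedAddCommGroup B] [NormedSpace ℝ B]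
    [TopologicalSpace H] {J : ModelWithCorners ℝ B H} [TopologicalSpace N] [ChartedSpace H N]
    {s : N → TM E M} {x : N} (hs : MDifferentiableAt J 𝓘(ℝ, E).tangent s x)
    (y : TangentSpace J x) :
    dproj (s x) (mfderiv J 𝓘(ℝ, E).tangent s x y) =
        vderiv J (fun x' ↦ baseCoord (s x).proj (s x')) x y ∧
      dfibre (s x) (mfderiv J 𝓘(ℝ, E).tangent s x y) =
        vderiv J (fun x' ↦ fibreCoord (s x).proj (s x')) x y := by
  have hc := mem_chart_source E (s x).proj
  have h1 := mfderiv_comp x (mdifferentiableAt_baseCoord hc) hs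
  have h2 := mfderiv_comp x (mdifferentiableAt_fibreCoord hc) hs
  rw [← tderiv_baseCoord_self, ← tderiv_fibreCoord_self]
  exact ⟨congrArg (fun A : B →L[ℝ] E ↦ A y) h1.symm, congrArg (fun A : B →L[ℝ] E ↦ A y) h2.symm⟩

lemma mdifferentiableAt_alongProj {f : ∀ u : TM E M, TanM (E := E) u.proj} {F : TM E M → E}
    {u : TM E M} (hF : MDifferentiableAt 𝓘(ℝ, E).tangent 𝓘(ℝ, E) F u)
    (h : ∀ᶠ u' in 𝓝 u, chartDeriv u.proj u'.proj (f u') = F u') :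
    MDifferentiableAt 𝓘(ℝ, E).tangent 𝓘(ℝ, E).tangent
        (fun u' ↦ (⟨u'.proj, f u'⟩ : TM E M)) u ∧
      (fun u' ↦ fibreCoord u.proj (⟨u'.proj, f u'⟩ : TM E M)) =ᶠ[𝓝 u] F := by
  have h1 : (fun u' ↦ fibreCoord u.proj (⟨u'.proj, f u'⟩ : TM E M)) =ᶠ[𝓝 u] F := by
    filter_upwards [h, eventually_chart_at u] with u' h1 h2
    exact (fibreCoord_eq (u := ⟨u'.proj, f u'⟩) h2).trans h1
  refine ⟨?_, h1⟩
  rw [mdifferentiableAt_totalSpace]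
  exact ⟨Bundle.mdifferentiableAt_proj _, h1.mdifferentiableAt_iff.2 hF⟩

/-- The covariant derivative of a section of `π^* TM` in coordinates. -/
lemma covDerivAlong_alongProj (g : Metric E M) {f : ∀ u : TM E M, TanM (E := E) u.proj}
    {F : TM E M → E} {u : TM E M} (hF : MDifferentiableAt 𝓘(ℝ, E).tangent 𝓘(ℝ, E) F u)
    (h : ∀ᶠ u' in 𝓝 u, chartDeriv u.proj u'.proj (f u') = F u') (y : TanTM u) :
    covDerivAlong (J := 𝓘(ℝ, E).tangent) g (fun u' ↦ (⟨u'.proj, f u'⟩ : TM E M)) u y =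
      tderiv F u y + christoffelIn g u.proj (baseCoord u.proj u) (dproj u y) (f u) := by
  obtain ⟨hs, he⟩ := mdifferentiableAt_alongProj hF h
  obtain ⟨h1, h2⟩ := dproj_mfderiv hs y
  have h1' := h1.trans (tderiv_baseCoord_self u y)
  have h2' := h2.trans (congrArg (fun A : TanTM u →L[ℝ] E ↦ A y) (tderiv_congr he))
  have h3 := christoffel_eq_christoffelMap g u.proj (dproj u y) (f u)
  unfold covDerivAlong connector
  have key (a a' b b' : E) (c : E → E) (ha : a = a') (hb : b = b') : a + c b = a' + c b' := by
    rw [ha, hb]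
  exact (key _ _ _ _ (fun z : E ↦ christoffel g u.proj z (f u)) h2' h1').trans
    (congrArg (@HAdd.hAdd E E E _ (tderiv F u y)) h3)

lemma tderiv_add {f f' : TM E M → E} {u : TM E M}
    (hf : MDifferentiableAt 𝓘(ℝ, E).tangent 𝓘(ℝ, E) f u)
    (hf' : MDifferentiableAt 𝓘(ℝ, E).tangent 𝓘(ℝ, E) f' u) (w : TanTM u) :
    tderiv (fun u' ↦ f u' + f' u') u w = tderiv f u w + tderiv f' u w := by
  have h : DifferentiableAt ℝ (fun z : E × E ↦ z.1 + z.2) (f u, f' u) := by fun_prop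
  rw [tderiv_comp (f := fun u' ↦ (f u', f' u')) (G := fun z : E × E ↦ z.1 + z.2) h
    (hf.prodMk_space hf'), tderiv_prodMk hf hf', fderiv_fun_add (by fun_prop) (by fun_prop)]
  simp [fderiv_fst, fderiv_snd]

section

variable [FiniteDimensional ℝ E]

/-- The fibre coordinate of `K X`, for a vector field `X` on `TM`. -/
def connectorComp (g : Metric E M) (p : M) (X : ∀ u : TM E M, TanTM u) (u : TM E M) : E :=
  fibreComp p X u + christoffelIn g p (baseCoord p u) (baseComp p X u) (fibreCoord p u)

/-- A vertical vector does not move the base point, so `Γ` is not differentiated. The product rule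
leaves one term from `X¹` and one from `v`, whose derivative along `vertLift u a` is `a`. -/
lemma tderiv_connectorComp (g : Metric E M) {X : ∀ u : TM E M, TanTM u} {u : TM E M}
    (hX : DifferentiableFieldAt X u) :
    MDifferentiableAt 𝓘(ℝ, E).tangent 𝓘(ℝ, E) (connectorComp g u.proj X) u ∧
      ∀ a : TanM (E := E) u.proj, tderiv (connectorComp g u.proj X) u (vertLift u a) =
        tderiv (fibreComp u.proj X) u (vertLift u a) +
          (christoffelIn g u.proj (baseCoord u.proj u)
              (tderiv (baseComp u.proj X) u (vertLift u a)) u.snd +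
            christoffelIn g u.proj (baseCoord u.proj u) (dproj u (X u)) a) := by
  have hs := mem_chart_source E u.proj
  have hb := mdifferentiableAt_baseCoord hs
  have hf := mdifferentiableAt_fibreCoord hs
  have hΓ : DifferentiableAt ℝ (christoffelIn g u.proj) (baseCoord u.proj u) :=
    differentiableAt_christoffelIn g (mem_extChartAt_target u.proj)
  have hΓ' : MDifferentiableAt 𝓘(ℝ, E).tangent 𝓘(ℝ, E →L[ℝ] E →L[ℝ] E)
      (fun u' ↦ christoffelIn g u.proj (baseCoord u.proj u')) u :=
    hΓ.mdifferentiableAt.comp u hb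
  have hΓX : MDifferentiableAt 𝓘(ℝ, E).tangent 𝓘(ℝ, E →L[ℝ] E)
      (fun u' ↦ christoffelIn g u.proj (baseCoord u.proj u') (baseComp u.proj X u')) u :=
    hΓ'.clm_apply hX.1
  have hΓXv := hΓX.clm_apply hf
  refine ⟨hX.2.add hΓXv, fun a ↦ ?_⟩
  unfold connectorComp
  rw [tderiv_add hX.2 hΓXv, tderiv_clm_apply hΓX hf, tderiv_clm_apply hΓ' hX.1,
    tderiv_comp hΓ hb, tderiv_baseCoord_self, dproj_vertLift, tderiv_fibreCoord_vertLift hs,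
    baseComp_self, fibreCoord_self, chartDeriv_self]
  have key (A : E →L[ℝ] E →L[ℝ] E →L[ℝ] E) (B : E →L[ℝ] E) (t r x v : E) :
      t + ((A 0 x + B) v + r) = t + (B v + r) := by
    rw [map_zero, zero_apply, zero_add]
  exact key _ _ _ _ _ _

/-- The Lie derivative of the mirror map in terms of the connection `∇^*`. -/
lemma lieDerivEnd_mirror_eq (g : Metric E M) {X Y : ∀ u : TM E M, TanTM u} {u : TM E M}
    (hX : DifferentiableFieldAt X u) (hY : DifferentiableFieldAt Y u) :
    lieDerivEnd mirror X Y u =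
      mirror u (nablaStar g X u (Y u)) - nablaStar g X u (mirror u (Y u)) := by
  obtain ⟨h1, h2⟩ := lieDerivEnd_mirror hX hY
  have hbase := covDerivAlong_alongProj g (f := fun u' ↦ dproj u' (X u')) hX.1
    (by filter_upwards [eventually_chart_at u] with u' h using (tderiv_baseCoord h _).symm)
  obtain ⟨hK, hKv⟩ := tderiv_connectorComp g hX
  have hfib := covDerivAlong_alongProj g (f := fun u' ↦ connector g u' (X u')) hK
    (by filter_upwards [eventually_chart_at u] with u' h using chartDeriv_connector g h _)
  -- `B ∇*_Y X` contributes `Γ(Y¹, X¹)` and `∇*_{BY} X` contributes `Γ(X¹, Y¹)`; this symmetry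
  -- cancels them.
  have hsymm := christoffelIn_symm g (mem_extChartAt_target (I := 𝓘(ℝ, E)) u.proj)
    (dproj u (X u)) (dproj u (Y u))
  have hzero (x : E) : christoffelIn g u.proj (baseCoord u.proj u) (0 : E) x = 0 := by simp
  have hB : covDerivAlong (J := 𝓘(ℝ, E).tangent) g
      (fun u' ↦ (⟨u'.proj, dproj u' (X u')⟩ : TM E M)) u (mirror u (Y u)) =
        tderiv (baseComp u.proj X) u (mirror u (Y u)) := by
    refine (hbase _).trans ?_
    rw [dproj_mirror]
    exact (congrArg _ (hzero _)).trans (add_zero _)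
  have hKB := hfib (mirror u (Y u))
  rw [dproj_mirror] at hKB
  have hKB' := hKB.trans ((congrArg _ (hzero _)).trans (add_zero _))
  apply tanTM_ext
  · rw [h1, map_sub, dproj_mirror]
    unfold nablaStar
    rw [map_add, dproj_horLift, dproj_vertLift, hB]
    have key (a : E) : -a = 0 - (a + 0) := by abel
    exact key _
  · rw [h2, map_sub, dfibre_mirror]
    unfold nablaStar
    rw [map_add, map_add, dproj_horLift, dproj_vertLift, dfibre_horLift, dfibre_vertLift, hB]
    -- Here `c` and `c'` are both `Γ(∂_{BY} X¹, v)`: one from differentiating `K X`, the other from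
    -- the horizontal lift in `∇*`.
    have key (k t c c' d d' f e : E) (hk : k = t + d) (he : e = f + (c + d')) (hc : c' = c)
        (hd : d' = d) : t - f = k + 0 - (-c' + e) := by
      rw [hk, he, hc, hd]; abel
    exact key _ _ _ _ _ _ _ _ (hbase (Y u)) (hKB'.trans (hKv _))
      (christoffel_eq_christoffelMap g _ _ _) hsymm

end

/-! ### Horizontal vector fields -/

/-- Extend `w` with constant coordinates. This allows an identity stated for fields `Y` to be tested
on a prescribed vector. -/
lemma exists_smoothFieldAtTM (u : TM E M) (w : TanTM u) :
    ∃ Y : ∀ u : TM E M, TanTM u, SmoothFieldAtTM Y u ∧ Y u = w := by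
  let e := trivializationAt (E × E) (TangentSpace 𝓘(ℝ, E).tangent : TM E M → Type _) u
  have hY {u' : TM E M} (h : u' ∈ (chartAt (ModelProd E E) u).source) :
      (e (⟨u', e.symm u' w⟩ : TangentBundle 𝓘(ℝ, E).tangent (TM E M))).2 = (w : E × E) :=
    congrArg Prod.snd (e.apply_mk_symm (by simpa [e] using h) (w : E × E))
  refine ⟨fun u' ↦ e.symm u' w, ?_, ?_⟩
  · refine (Bundle.contMDiffAt_section (IB := 𝓘(ℝ, E).tangent) (n := ∞) u).2 ?_
    refine (contMDiffAt_const (M' := E × E) (c := w)).congr_of_eventuallyEq ?_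
    filter_upwards [(chartAt (ModelProd E E) u).open_source.mem_nhds (mem_chart_source _ u)]
      with u' h
    exact hY h
  · have h1 := trivializationAt_snd_eq_vderiv (J := 𝓘(ℝ, E).tangent)
      (mem_chart_source (ModelProd E E) u) (e.symm u w)
    have h2 : vderiv 𝓘(ℝ, E).tangent (extChartAt 𝓘(ℝ, E).tangent u) u =
        (ContinuousLinearMap.id ℝ (E × E) : E × E →L[ℝ] E × E) :=
      mfderiv_extChartAt_self
    exact ((congrArg (fun A : E × E →L[ℝ] E × E ↦ A (e.symm u w)) h2).symm.trans h1.symm).trans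
      (hY (mem_chart_source _ u))

lemma SmoothFieldOnTM.smoothFieldAtTM {X : ∀ u : TM E M, TanTM u} {U : Set M} (hU : IsOpen U)
    (hX : SmoothFieldOnTM X {u | u.proj ∈ U}) {u : TM E M} (hu : u.proj ∈ U) :
    SmoothFieldAtTM X u :=
  ContMDiffOn.contMDiffAt hX
    ((FiberBundle.continuous_proj E (TangentSpace 𝓘(ℝ, E))).continuousAt.preimage_mem_nhds
      (hU.mem_nhds hu))

lemma covDerivAlong_congr {B H N : Type*} [NormedAddCommGroup B] [NormedSpace ℝ B]
    [TopologicalSpace H] {J : ModelWithCorners ℝ B H} [TopologicalSpace N] [ChartedSpace H N]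
    (g : Metric E M) {s s' : N → TM E M} {x : N} (h : s =ᶠ[𝓝 x] s') (y : TangentSpace J x) :
    (covDerivAlong g s x y : E) = covDerivAlong g s' x y := by
  have key (u u' : TM E M) (w w' : E × E) (hu : u = u') (hw : w = w') :
      (connector g u w : E) = connector g u' w' := by rw [hu, hw]
  have h' : (mfderiv J 𝓘(ℝ, E).tangent s x : B →L[ℝ] E × E) = mfderiv J 𝓘(ℝ, E).tangent s' x :=
    h.mfderiv_eq
  exact key _ _ _ _ h.self_of_nhds (congrArg (fun A : B →L[ℝ] E × E ↦ A y) h')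

/-- The pull-back connection on `π^* TM` of a section coming from `M`. -/
lemma covDerivAlong_comp_proj (g : Metric E M) {X : ∀ p : M, TanM (E := E) p} {u : TM E M}
    (hX : MDifferentiableAt 𝓘(ℝ, E) 𝓘(ℝ, E).tangent (fun q ↦ (⟨q, X q⟩ : TM E M)) u.proj)
    (y : TanTM u) :
    covDerivAlong (J := 𝓘(ℝ, E).tangent) g (fun u' ↦ (⟨u'.proj, X u'.proj⟩ : TM E M)) u y =
      nabla g X u.proj (dproj u y) := by
  have h1 : MDifferentiableAt 𝓘(ℝ, E).tangent 𝓘(ℝ, E) (fun u' : TM E M ↦ u'.proj) u :=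
    Bundle.mdifferentiableAt_proj _
  have h := mfderiv_comp u hX h1
  exact congrArg (fun A : E × E →L[ℝ] E × E ↦
    connector g (⟨u.proj, X u.proj⟩ : TM E M) (A y)) h

lemma christoffel_zero_left (g : Metric E M) (p : M) (b : TanM (E := E) p) :
    christoffel g p 0 b = 0 := by
  rw [christoffel_eq_christoffelMap]
  have key (A : E →L[ℝ] E →L[ℝ] E) (b : E) : A 0 b = 0 := by simp
  exact key _ _

lemma horLift_zero (g : Metric E M) (u : TM E M) : horLift g u 0 = 0 := by
  simp [horLift, christoffel_zero_left]

/-- The connection `∇^*` on horizontal vector fields. -/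
lemma nablaStar_of_isHorizontal (g : Metric E M) {X : ∀ u : TM E M, TanTM u} {u : TM E M}
    (hX : ∀ᶠ u' in 𝓝 u, IsHorizontal g (X u')) (y : TanTM u) :
    nablaStar g X u y = horLift g u (covDerivAlong (J := 𝓘(ℝ, E).tangent) g
      (fun u' ↦ (⟨u'.proj, dproj u' (X u')⟩ : TM E M)) u y) := by
  have h := covDerivAlong_alongProj g (f := fun u' ↦ connector g u' (X u')) (F := fun _ ↦ (0 : E))
    (u := u) mdifferentiableAt_const (by
      filter_upwards [hX] with u' h
      have h' : connector g u' (X u') = 0 := h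
      rw [h', map_zero]) y
  have hu : connector g u (X u) = 0 := hX.self_of_nhds
  have key (A : E →L[ℝ] E →L[ℝ] E) (w : TanTM u) (z : E) (hz : z = 0) :
      tderiv (fun _ : TM E M ↦ (0 : E)) u y + A (dproj u w) z = 0 := by
    rw [tderiv_const, hz, map_zero, zero_apply, add_zero]
  have h0 := h.trans (key _ y _ hu)
  unfold nablaStar
  rw [h0]
  have : vertLift u (0 : E) = 0 := map_zero (vertLift u)
  exact (congrArg _ this).trans (add_zero _)

section

variable [FiniteDimensional ℝ E]

lemma lieDerivEnd_mirror_of_isHorizontal (g : Metric E M) {X Y : ∀ u : TM E M, TanTM u}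
    {u : TM E M} (hX : DifferentiableFieldAt X u) (hY : DifferentiableFieldAt Y u)
    (hh : ∀ᶠ u' in 𝓝 u, IsHorizontal g (X u')) :
    lieDerivEnd mirror X Y u =
      vertLift u (covDerivAlong (J := 𝓘(ℝ, E).tangent) g
        (fun u' ↦ (⟨u'.proj, dproj u' (X u')⟩ : TM E M)) u (Y u)) -
      horLift g u (covDerivAlong (J := 𝓘(ℝ, E).tangent) g
        (fun u' ↦ (⟨u'.proj, dproj u' (X u')⟩ : TM E M)) u (mirror u (Y u))) := by
  rw [lieDerivEnd_mirror_eq g hX hY, nablaStar_of_isHorizontal g hh,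
    nablaStar_of_isHorizontal g hh, mirror, ContinuousLinearMap.comp_apply]
  congr 2
  exact dproj_horLift g u _

/-- If `X` is horizontal and `dπ X` comes from a vector field on `M`, then `L_X B` is given by the
covariant derivative of that vector field. -/
lemma lieDerivEnd_mirror_horLift (g : Metric E M) {Xh Y : ∀ u : TM E M, TanTM u}
    {X : ∀ p : M, TanM (E := E) p} {u : TM E M} (hX : DifferentiableFieldAt Xh u)
    (hY : DifferentiableFieldAt Y u)
    (hXm : MDifferentiableAt 𝓘(ℝ, E) 𝓘(ℝ, E).tangent (fun q ↦ (⟨q, X q⟩ : TM E M)) u.proj)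
    (hh : ∀ᶠ u' in 𝓝 u, Xh u' = horLift g u' (X u'.proj)) :
    lieDerivEnd mirror Xh Y u = vertLift u (nabla g X u.proj (dproj u (Y u))) := by
  have hs : (fun u' ↦ (⟨u'.proj, dproj u' (Xh u')⟩ : TM E M)) =ᶠ[𝓝 u]
      fun u' ↦ (⟨u'.proj, X u'.proj⟩ : TM E M) := by
    filter_upwards [hh] with u' h
    rw [h, dproj_horLift]
  have hc (y : TanTM u) := (covDerivAlong_congr (J := 𝓘(ℝ, E).tangent) g hs y).trans
    (covDerivAlong_comp_proj g hXm y)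
  -- Since `BY` is vertical, the horizontal term differentiates `X` in direction `0` and disappears.
  have h0 : nabla g X u.proj 0 = 0 := by
    have h1 : nabla g X u.proj (dproj u 0) = _ := (covDerivAlong_comp_proj g hXm 0).symm
    rw [map_zero] at h1
    rw [h1]
    unfold covDerivAlong connector
    rw [map_zero, map_zero, map_zero, christoffel_zero_left, add_zero]
  rw [lieDerivEnd_mirror_of_isHorizontal g hX hY (by
    filter_upwards [hh] with u' h
    rw [h]
    exact connector_horLift g u' _)]
  have h1 := hc (Y u)
  have h2 := hc (mirror u (Y u))
  rw [dproj_mirror, h0] at h2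
  refine (congrArg₂ (fun a b : E ↦ (vertLift u a - horLift g u b : TanTM u)) h1 h2).trans ?_
  exact (congrArg _ (horLift_zero g u)).trans (sub_zero _)

end

/-- If the base component of a vector field on `TM` has vanishing derivatives along a fibre, then
`dπ X` is constant along this fibre. -/
lemma dproj_eq_of_tderiv_vertLift_eq_zero {X : ∀ u : TM E M, TanTM u} {p : M}
    (hX : ∀ u : TM E M, u.proj = p → DifferentiableFieldAt X u)
    (h : ∀ u : TM E M, u.proj = p →
      ∀ a : TanM (E := E) u.proj, tderiv (baseComp u.proj X) u (vertLift u a) = 0) (v v' : E) :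
    (dproj (⟨p, v⟩ : TM E M) (X ⟨p, v⟩) : E) = dproj (⟨p, v'⟩ : TM E M) (X ⟨p, v'⟩) := by
  have h1 : Differentiable ℝ (fun v : E ↦ baseComp p X (⟨p, v⟩ : TM E M)) := fun v ↦
    ((hX ⟨p, v⟩ rfl).1.comp (I := 𝓘(ℝ, E)) v
      ((contMDiff_fibreInclusion p).contMDiffAt.mdifferentiableAt (by decide))).differentiableAt
  have h2 (v : E) : fderiv ℝ (fun v : E ↦ baseComp p X (⟨p, v⟩ : TM E M)) v = 0 := by
    ext a
    exact (tderiv_vertLift (u := (⟨p, v⟩ : TM E M)) (hX ⟨p, v⟩ rfl).1 a).symm.trans (h ⟨p, v⟩ rfl a)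
  have h3 := is_const_of_fderiv_eq_zero (𝕜 := ℝ) h1 h2 v v'
  exact (baseComp_self X ⟨p, v⟩).symm.trans (h3.trans (baseComp_self X ⟨p, v'⟩))

/-- The field is `dπ X` restricted to the zero section, which is smooth. -/
lemma smoothFieldOn_dproj_zero {X : ∀ u : TM E M, TanTM u} {U : Set M} (hU : IsOpen U)
    (hX : SmoothFieldOnTM X {u | u.proj ∈ U}) :
    SmoothFieldOn (fun p : M ↦ dproj (⟨p, 0⟩ : TM E M) (X ⟨p, 0⟩)) U := by
  intro p hp
  refine ContMDiffAt.contMDiffWithinAt ((Bundle.contMDiffAt_section p).2 ?_)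
  have h1 := (hX.smoothFieldAtTM hU (u := ⟨p, 0⟩) hp).contMDiffAt_comp.1.comp p
    (Bundle.contMDiff_zeroSection ℝ (TangentSpace 𝓘(ℝ, E) : M → Type _) p)
  refine h1.congr_of_eventuallyEq ?_
  filter_upwards [(chartAt E p).open_source.mem_nhds (mem_chart_source E p)] with q hq
  exact (fibreCoord_eq (p := p) (u := (⟨q, dproj (⟨q, 0⟩ : TM E M) (X ⟨q, 0⟩)⟩ : TM E M)) hq).trans
    (tderiv_baseCoord (u := (⟨q, 0⟩ : TM E M)) hq _).symm

end MirrorMap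

end

/-! ### The theorem -/

open MirrorMap in
theorem proposition2p2
    {E : Type*} [NormedAddCommGroup E] [NormedSpace ℝ E] [FiniteDimensional ℝ E]
    {M : Type*} [TopologicalSpace M] [ChartedSpace E M] [IsManifold 𝓘(ℝ, E) ∞ M]
    (g : Metric E M) (U : Set M) (hU : IsOpen U) :
    (∀ X : ∀ u : TM E M, TanTM u, SmoothFieldOnTM X {u | u.proj ∈ U} →
      ∀ u : TM E M, u.proj ∈ U → ∀ Y : ∀ u : TM E M, TanTM u, SmoothFieldAtTM Y u →
        lieDerivEnd mirror X Y u =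
          mirror u (nablaStar g X u (Y u)) - nablaStar g X u (mirror u (Y u))) ∧
    (∀ Xh : ∀ u : TM E M, TanTM u, SmoothFieldOnTM Xh {u | u.proj ∈ U} →
      (∀ u : TM E M, u.proj ∈ U → IsHorizontal g (Xh u)) →
      ∀ lam : TM E M → ℝ,
        ((∀ u : TM E M, u.proj ∈ U → ∀ Y : ∀ u : TM E M, TanTM u, SmoothFieldAtTM Y u →
            lieDerivEnd mirror Xh Y u = lam u • mirror u (Y u)) ↔
          (∀ u u' : TM E M, u.proj ∈ U → u.proj = u'.proj → lam u = lam u') ∧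
          ∃ X : ∀ p : M, TanM (E := E) p, SmoothFieldOn X U ∧
            (∀ u : TM E M, u.proj ∈ U → Xh u = horLift g u (X u.proj)) ∧
            ∀ u : TM E M, u.proj ∈ U → ∀ y : TanM (E := E) u.proj,
              nabla g X u.proj y = lam u • y)) := by
  refine ⟨fun X hX u hu Y hY ↦ lieDerivEnd_mirror_eq g
    (hX.smoothFieldAtTM hU hu).differentiableFieldAt hY.differentiableFieldAt, ?_⟩
  intro Xh hXh hhor lam
  have hd (u : TM E M) (hu : u.proj ∈ U) : DifferentiableFieldAt Xh u :=
    (hXh.smoothFieldAtTM hU hu).differentiableFieldAt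
  have hnhds (u : TM E M) (hu : u.proj ∈ U) : ∀ᶠ u' in 𝓝 u, u'.proj ∈ U :=
    (FiberBundle.continuous_proj E (TangentSpace 𝓘(ℝ, E))).continuousAt.preimage_mem_nhds
      (hU.mem_nhds hu)
  have hmd (X : ∀ p : M, TanM (E := E) p) (hX : SmoothFieldOn X U) (p : M) (hp : p ∈ U) :
      MDifferentiableAt 𝓘(ℝ, E) 𝓘(ℝ, E).tangent (fun q ↦ (⟨q, X q⟩ : TM E M)) p :=
    (ContMDiffOn.contMDiffAt hX (hU.mem_nhds hp)).mdifferentiableAt (by decide)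
  constructor
  · intro hL
    -- Any `Y` with `dπ Y = a` at `u` will do: `BY` is then the vertical lift of `a`, and `λ BY` has
    -- no base component.
    have hvert (u : TM E M) (hu : u.proj ∈ U) (a : TanM (E := E) u.proj) :
        tderiv (baseComp u.proj Xh) u (vertLift u a) = 0 := by
      obtain ⟨Y, hY, hYu⟩ := exists_smoothFieldAtTM u (coordLift u a)
      have h1 := (lieDerivEnd_mirror (hd u hu) hY.differentiableFieldAt).1
      rw [hL u hu Y hY, map_smul, dproj_mirror, smul_zero, hYu, mirror,
        ContinuousLinearMap.comp_apply, dproj_coordLift] at h1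
      exact neg_eq_zero.1 h1.symm
    -- As `dπ Xh` is constant on fibres, its value at the zero vector represents it.
    let X : ∀ p : M, TanM (E := E) p := fun p ↦ dproj (⟨p, 0⟩ : TM E M) (Xh ⟨p, 0⟩)
    have hX : SmoothFieldOn X U := smoothFieldOn_dproj_zero hU hXh
    have hlift (u : TM E M) (hu : u.proj ∈ U) : Xh u = horLift g u (X u.proj) := by
      have h1 : dproj u (Xh u) = X u.proj :=
        dproj_eq_of_tderiv_vertLift_eq_zero (p := u.proj)
          (fun u' hu' ↦ hd u' (hu' ▸ hu)) (fun u' hu' ↦ hvert u' (hu' ▸ hu)) u.snd 0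
      rw [← h1]
      exact eq_horLift_of_isHorizontal (hhor u hu)
    have hnabla (u : TM E M) (hu : u.proj ∈ U) (y : TanM (E := E) u.proj) :
        nabla g X u.proj y = lam u • y := by
      obtain ⟨Y, hY, hYu⟩ := exists_smoothFieldAtTM u (coordLift u y)
      have h1 := lieDerivEnd_mirror_horLift g (hd u hu) hY.differentiableFieldAt
        (hmd X hX u.proj hu) (by filter_upwards [hnhds u hu] with u' hu' using hlift u' hu')
      rw [hL u hu Y hY, hYu, dproj_coordLift] at h1
      have h2 := congrArg (dfibre u) h1
      rw [dfibre_vertLift, map_smul, dfibre_mirror, dproj_coordLift] at h2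
      exact h2.symm
    refine ⟨?_, X, hX, hlift, hnabla⟩
    rintro ⟨p, v⟩ ⟨p', v'⟩ hp (rfl : p = p')
    -- If `E = 0`, each fibre is a single point. Otherwise a nonzero `y` recovers `λ` from `∇_y X =
    -- λ y`, whose left side depends only on the base point.
    rcases subsingleton_or_nontrivial E with hE | hE
    · have : v = v' := hE.elim (v : E) (v' : E)
      rw [this]
    · obtain ⟨y, hy⟩ := exists_ne (0 : E)
      have h1 : (lam ⟨p, v⟩ • y : E) = lam ⟨p, v'⟩ • y :=
        (hnabla ⟨p, v⟩ hp y).symm.trans (hnabla ⟨p, v'⟩ hp y)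
      exact smul_left_injective ℝ hy h1
  · rintro ⟨-, X, hX, hlift, hnabla⟩ u hu Y hY
    rw [lieDerivEnd_mirror_horLift g (hd u hu) hY.differentiableFieldAt
        (hmd X hX u.proj hu) (by filter_upwards [hnhds u hu] with u' hu' using hlift u' hu'),
      hnabla u hu, map_smul]
    rfl
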